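/- Let $\mathbb X$ be a compact connected Riemannian manifold without boundary, $\rho$ its geodesic distance, $B(x,r)=\{y:\rho(x,y)\le r\}$, and $\mu$ a Borel probability measure on $\mathbb X$ such that, for some $\alpha,\kappa_1>0$, $$\mu(B(x,r))\le\kappa_1r^\alpha,\qquad x\in\mathbb X,\ r>0.$$ Let $\kappa_2,\kappa_3,\kappa_4>0$, $\kappa\ge1$ and $A\ge2$. We consider systems $(\{\phi_k\}_{k\ge0},\{\ell_k\}_{k\ge0})$ of the following kind. * $\{\phi_k\}$ is an orthonormal system in $L^2(\mu)$ of continuous complex-valued functions with $\phi_0\equiv1$, and $\{\ell_k\}$ is a nondecreasing real sequence with $\ell_0=1$ and $\ell_k\to\infty$. * The heat kernel $K_t(x,y)=\sum_{k=0}^\infty e^{-\ell_k^2t}\phi_k(x)\overline{\phi_k(y)}$ is differentiable in $y$ and satisfies, for all $x,y\in\mathbb X$ and $t\in(0,1]$, $$|K_t(x,y)|\le\kappa_2t^{-\alpha/2}e^{-\kappa_3\rho(x,y)^2/t},\qquad \|\nabla_yK_t(x,y)\|\le\kappa_2t^{-\alpha/2-1/2}e^{-\kappa_3\rho(x,y)^2/t},\qquad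 K_t(x,x)\ge\kappa_4t^{-\alpha/2},$$ where $\|\nabla_yK_t(x,y)\|$ is the norm, with respect to the Riemannian metric, of the differential of $K_t(x,\cdot)$ at $y$. * Each $\phi_k$ is differentiable, and for every smooth vector field $F$ the sequence $\{F\phi_k\}$ is a Bessel system. Here $\{\psi_k\}\subset L^2(\mu)$ is a Bessel system if there is a set $D$, dense in $C(\mathbb X)$ for the norm $\|\cdot\|_{L^1(\mu)}+\|\cdot\|_{L^\infty(\mu)}$, such that (i) for all $\epsilon>0$, $x\in\mathbb X$, $r>0$ and $f\in C(\mathbb X)$ supported in $B(x,r)$ there is $g\in D$ supported in $B(x,2r)$ with $\|f-g\|_{L^1(\mu)}\le\epsilon$, and (ii) $\sum_k|\langle f,\psi_k\rangle_{L^2(\mu)}|^2<\infty$ for every $f\in D$. For $L\in\mathbb R$ let $\Pi_L$ be the complex linear span of $\{\phi_j:\ell_j\le L\}$. For a finite nonempty set $\mathcal C\subset\mathbb X$ let $$\delta(\mathcal C)=\sup_{x\in\mathbb X}\rho(x,\mathcal C),\qquad q(\mathcal C)=\min_{x,y\in\mathcal C,\,x\ne y}\rho(x,y)$$ (with $q(\mathcal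 C)=0$ if $\mathcal C$ has only one point). Theorem. There are constants $c_1,c_2,c_3,c_4>0$, depending only on $\mathbb X,\rho,\mu,\alpha,\kappa_1,\dots,\kappa_4,\kappa,A$, such that for every system $(\{\phi_k\},\{\ell_k\})$ as above and every finite nonempty set $\mathcal C=\{x_1,\dots,x_M\}\subset\mathbb X$ of distinct points with $$\tfrac12q(\mathcal C)\le\delta(\mathcal C)\le\kappa\,q(\mathcal C),$$ writing $\delta=\delta(\mathcal C)$, the following hold. (a) If $1\le p<\infty$, $0<\eta\le1$, $\delta\le c_1$, $L\le c_2\eta/(p\delta)$ and $P\in\Pi_L$, then $$\sum_{k=1}^M\mu(B(x_k,\delta))\sup_{z,y\in B(x_k,A\delta)}\bigl||P(z)|^p-|P(y)|^p\bigr|\le\eta\int_{\mathbb X}|P|^p\,d\mu.$$ (b) If $1\le p<\infty$, $0<\eta\le1$, $\delta\le c_1$, $\{Y_k\}_{k=1}^M$ is a partition of $\mathbb X$ into Borel sets with $x_k\in Y_k\subseteq B(x_k,A\delta)$ for each $k$, $L\le c_3\eta/(p\delta)$ and $P\in\Pi_L$, then $$\Bigl|\int_{\mathbb X}|P|^p\,d\mu-\sum_{k=1}^M\mu(Y_k)|P(x_k)|^p\Bigr|\le\eta\int_{\mathbb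 X}|P|^p\,d\mu.$$ (c) If $\eta>0$, $L\le c_4\eta/\delta$ and $P\in\Pi_L$, then $$\Bigl|\|P\|_{L^\infty(\mu)}-\max_{1\le k\le M}|P(x_k)|\Bigr|\le\eta\,\|P\|_{L^\infty(\mu)}.$$ -/

import Mathlib

open MeasureTheory Filter Bundle
open scoped Manifold ContDiff ENNReal

namespace DiffusionMZ

/-- The heat kernel `K_t(x,y) = ∑ₖ exp(-ℓₖ² t) φₖ(x) conj(φₖ(y))`.  Under the lower bound for
`K_t(x,x)` in `HeatKernelBounds` the series converges absolutely for all `x, y` (a divergent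
series would have the value `0` on the diagonal; off the diagonal use Cauchy-Schwarz). -/
noncomputable def heatKernel {X : Type*} (φ : ℕ → X → ℂ) (ℓ : ℕ → ℝ) (t : ℝ) (x y : X) : ℂ :=
  ∑' k, (Real.exp (-(ℓ k) ^ 2 * t) : ℂ) * φ k x * (starRingEnd ℂ) (φ k y)

/-- The space `Π_L = span {φⱼ : ℓⱼ ≤ L}` of diffusion polynomials of degree at most `L`. -/
def diffusionPolynomials {X : Type*} (φ : ℕ → X → ℂ) (ℓ : ℕ → ℝ) (L : ℝ) :
    Submodule ℂ (X → ℂ) :=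
  Submodule.span ℂ {f | ∃ j, ℓ j ≤ L ∧ f = φ j}

/-- The mesh norm `δ(C) = sup_{x ∈ X} ρ(x, C)`. -/
noncomputable def meshNorm {X : Type*} [MetricSpace X] (C : Finset X) : ℝ :=
  ⨆ x : X, Metric.infDist x (C : Set X)

/-- The minimal separation `q(C) = min {ρ(x, y) : x, y ∈ C, x ≠ y}`. -/
noncomputable def minSeparation {X : Type*} [MetricSpace X] (C : Finset X) : ℝ :=
  (C : Set X).infsep

/-- A sequence of functions of `L²(μ)` is a Bessel system if some set `D` of continuous functions,
dense for the norm `‖·‖₁ + ‖·‖_∞`, satisfies: (i) continuous functions supported in a ball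
`B(x,r)` can be approximated in `L¹(μ)` by members of `D` supported in `B(x,2r)`;
(ii) `∑ₖ |⟨f, ψₖ⟩|² < ∞` for every `f ∈ D`. -/
def IsBesselSystem {X : Type*} [MetricSpace X] [MeasurableSpace X] (μ : Measure X)
    (ψ : ℕ → X → ℂ) : Prop :=
  (∀ k, MemLp (ψ k) 2 μ) ∧
  ∃ D : Set C(X, ℂ),
    (∀ f : C(X, ℂ), ∀ ε : ℝ≥0∞, 0 < ε →
      ∃ g ∈ D, eLpNorm (fun x => f x - g x) 1 μ + eLpNorm (fun x => f x - g x) ∞ μ < ε) ∧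
    (∀ ε : ℝ≥0∞, 0 < ε → ∀ (x : X) (r : ℝ), 0 < r → ∀ f : C(X, ℂ),
      tsupport f ⊆ Metric.closedBall x r →
      ∃ g ∈ D, tsupport g ⊆ Metric.closedBall x (2 * r) ∧
        eLpNorm (fun x => f x - g x) 1 μ ≤ ε) ∧
    (∀ f ∈ D, Summable fun k => ‖∫ x, f x * (starRingEnd ℂ) (ψ k x) ∂μ‖ ^ 2)

/-- `φ` is an orthonormal system of continuous functions with `φ₀ = 1`, and `ℓ` is a nondecreasing
sequence with `ℓ₀ = 1` and limit `∞`. -/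
structure IsOrthonormalSystem {X : Type*} [TopologicalSpace X] [MeasurableSpace X]
    (μ : Measure X) (φ : ℕ → X → ℂ) (ℓ : ℕ → ℝ) : Prop where
  continuous : ∀ k, Continuous (φ k)
  orthonormal : ∀ j k, ∫ x, φ j x * (starRingEnd ℂ) (φ k x) ∂μ = if j = k then 1 else 0
  phi_zero : ∀ x, φ 0 x = 1
  mono : Monotone ℓ
  ell_zero : ℓ 0 = 1
  tendsto : Tendsto ℓ atTop atTop

section Manifold

variable {n : ℕ} {X : Type*} [MetricSpace X] [ChartedSpace (EuclideanSpace ℝ (Fin n)) X]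

/-- The derivative `v f = df_x(v)` of a complex-valued function `f` along a tangent vector `v`
at `x`. -/
noncomputable def dirDeriv (f : X → ℂ) (x : X) (v : TangentSpace (𝓡 n) x) : ℂ :=
  mfderiv (𝓡 n) 𝓘(ℝ, ℂ) f x v

/-- The functions `φₖ` are differentiable, and for every smooth vector field `F` the system
`{F φₖ}` is a Bessel system. -/
def BesselCondition [IsManifold (𝓡 n) ∞ X] [MeasurableSpace X] (μ : Measure X)
    (φ : ℕ → X → ℂ) : Prop :=
  (∀ k, MDifferentiable (𝓡 n) 𝓘(ℝ, ℂ) (φ k)) ∧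
  ∀ F : ∀ x : X, TangentSpace (𝓡 n) x,
    ContMDiff (𝓡 n) (𝓡 n).tangent ∞ (fun x => (⟨x, F x⟩ : TangentBundle (𝓡 n) X)) →
    IsBesselSystem μ (fun k x => dirDeriv (φ k) x (F x))

/-- Gaussian upper bounds for the heat kernel and for its gradient in the second variable, and the
lower bound on the diagonal.  The length of the gradient of `f` at `y` is the norm of the
differential of `f` at `y`, i.e. the least `b ≥ 0` with `|df_y(v)| ≤ b |v|` for all `v`. -/
structure HeatKernelBounds [RiemannianBundle (fun x : X => TangentSpace (𝓡 n) x)]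
    (α κ₂ κ₃ κ₄ : ℝ) (φ : ℕ → X → ℂ) (ℓ : ℕ → ℝ) : Prop where
  upper : ∀ t : ℝ, 0 < t → t ≤ 1 → ∀ x y : X,
    ‖heatKernel φ ℓ t x y‖ ≤ κ₂ * t ^ (-α / 2) * Real.exp (-κ₃ * dist x y ^ 2 / t)
  differentiable : ∀ t : ℝ, 0 < t → t ≤ 1 → ∀ x : X,
    MDifferentiable (𝓡 n) 𝓘(ℝ, ℂ) (heatKernel φ ℓ t x)
  gradient : ∀ t : ℝ, 0 < t → t ≤ 1 → ∀ x y : X, ∀ v : TangentSpace (𝓡 n) y,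
    ‖dirDeriv (heatKernel φ ℓ t x) y v‖ ≤
      κ₂ * t ^ (-α / 2 - 1 / 2) * Real.exp (-κ₃ * dist x y ^ 2 / t) * ‖v‖
  lower : ∀ t : ℝ, 0 < t → t ≤ 1 → ∀ x : X,
    κ₄ * t ^ (-α / 2) ≤ (heatKernel φ ℓ t x x).re

end Manifold

end DiffusionMZ

/-! Everything rests on one local oscillation estimate. Put r = 1/L. For P in Π_L and y, z within Aδ
of x₀, with δ ≤ r ≤ 1, |P(y) - P(z)| ≤ K (δ/r) ∫ |P(u)| r^(-α) (1 + ρ(x₀,u)/r)^(-m) dμ(u), where K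
depends only on the fixed data (`exists_norm_sub_le`).

To prove it, let T be the integral operator with kernel K_{r²}. It is self-adjoint, and on Π_L its
eigenvalues exp(-ℓ_j² r²) lie in [1/e, 1]. If g is a Schwartz function equal to λ⁻² on [1/e, 1],
then T g(T) T acts as the identity on Π_L, so P(y) - P(z) = ⟨g(T)h, TP⟩ with h = K_{r²}(·,y) -
K_{r²}(·,z). The gradient bound and the mean value inequality make h of relative size δ/r and
rapidly decaying away from x₀ at scale r. It remains to see that g(T) preserves polynomial decay.
The powers of the weight w = 1 + ρ(x₀,·)/r almost commute with T: the commutator of w^(k+1) with T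
is controlled by w^k. Hence exp(isT) grows only polynomially in s in the norm ‖w^m f‖, and g(T) = ∫
ĝ(s) exp(2πisT) ds is bounded in that norm because ĝ decays rapidly (`norm_weight_unitaryGroup_le`,
`exists_schwartz_functional_calculus`, `exists_heatOperator`).

The diagonal lower bound for the kernel also gives μ(B(x,r)) ≥ c r^α
(`exists_le_measure_closedBall`), so separated points have balls of bounded overlap.

Part (c) follows from the oscillation estimate by comparing any point with its nearest node. For
(a), the estimate is inserted in ||P(y)|^p - |P(z)|^p| ≤ p s^(p-1) ||P(y)| - |P(z)||, s being the
local maximum of |P|, and summed over the nodes. The resulting sum of μ(B) s^p is at most a multiple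
of ∫|P|^p plus the oscillation sum itself, which is absorbed on the left
(`sum_measure_mul_iSup_le`). Part (b) follows from (a), since μ(Y_k) is at most a constant times
μ(B(x_k,δ)). -/

namespace DiffusionMZ

/-! ### Mean value inequality along curves of nearly minimal length. -/

/-- Mean value inequality on a Riemannian manifold: if the differential of `f` has norm at most `B`
on the ball `B(y, R)`, then `|f y - f z| ≤ B R` whenever `ρ(y, z) < R`. -/
theorem norm_sub_le_of_norm_dirDeriv_le {n : ℕ} {X : Type*} [MetricSpace X]
    [ChartedSpace (EuclideanSpace ℝ (Fin n)) X] [IsManifold (𝓡 n) ∞ X]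
    [RiemannianBundle (fun x : X => TangentSpace (𝓡 n) x)]
    [IsContMDiffRiemannianBundle (𝓡 n) ∞ (EuclideanSpace ℝ (Fin n))
      (fun x : X => TangentSpace (𝓡 n) x)]
    [IsRiemannianManifold (𝓡 n) X]
    {f : X → ℂ} (hf : MDifferentiable (𝓡 n) 𝓘(ℝ, ℂ) f) {y z : X} {B R : ℝ} (hB : 0 ≤ B)
    (hyz : dist y z < R)
    (h : ∀ u, dist y u < R → ∀ v : TangentSpace (𝓡 n) u, ‖dirDeriv f u v‖ ≤ B * ‖v‖) :
    ‖f y - f z‖ ≤ B * R := by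
  have hR : 0 < R := dist_nonneg.trans_lt hyz
  have : IsManifold (𝓡 n) 1 X := IsManifold.of_le (n := ∞) (by simp)
  have : IsContMDiffRiemannianBundle (𝓡 n) 1 (EuclideanSpace ℝ (Fin n))
      (fun x : X => TangentSpace (𝓡 n) x) := IsContMDiffRiemannianBundle.of_le (n := ∞) (by simp)
  have hlt : Manifold.riemannianEDist (𝓡 n) y z < ENNReal.ofReal R := by
    rw [← IsRiemannianManifold.out y z, edist_dist]
    exact (ENNReal.ofReal_lt_ofReal_iff hR).2 hyz
  obtain ⟨γ, h0, h1, hγ, hlen, -, -⟩ :=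
    Manifold.exists_lt_locally_constant_of_riemannianEDist_lt hlt zero_lt_one
  -- The curve has total length less than R, so each initial piece keeps it inside the ball where
  -- the differential is bounded.
  have hmem : ∀ s ∈ Set.Icc (0 : ℝ) 1, dist y (γ s) < R := by
    intro s hs
    have h2 := (Manifold.riemannianEDist_le_pathELength (I := 𝓡 n) (γ := γ) (a := 0) (b := s)
      hγ.contMDiffOn rfl rfl hs.1).trans (Manifold.pathELength_mono le_rfl hs.2)
    have h3 := h2.trans_lt hlen
    rw [← IsRiemannianManifold.out, h0, edist_dist] at h3
    exact (ENNReal.ofReal_lt_ofReal_iff hR).1 h3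
  have hγd : MDifferentiable 𝓘(ℝ, ℝ) (𝓡 n) γ := hγ.mdifferentiable one_ne_zero
  have key : ∀ (s : ℝ) (D : ℝ →L[ℝ] ℂ), HasMFDerivAt 𝓘(ℝ, ℝ) 𝓘(ℝ, ℂ) (f ∘ γ) s D →
      HasDerivAt (f ∘ γ) (D 1) s := fun s D hD =>
    HasFDerivAt.hasDerivAt (hasMFDerivAt_iff_hasFDerivAt.1 hD)
  have hder : ∀ s, HasDerivAt (f ∘ γ)
      (dirDeriv f (γ s) (mfderiv 𝓘(ℝ, ℝ) (𝓡 n) γ s (1 : ℝ))) s := by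
    intro s
    have h4 : HasMFDerivAt 𝓘(ℝ, ℝ) 𝓘(ℝ, ℂ) (f ∘ γ) s _ :=
      HasMFDerivAt.comp s (hf (γ s)).hasMFDerivAt (hγd s).hasMFDerivAt
    exact key s _ h4
  have hle : ∫⁻ s in Set.Icc (0 : ℝ) 1, ‖deriv (f ∘ γ) s‖ₑ ≤ ENNReal.ofReal (B * R) := by
    calc ∫⁻ s in Set.Icc (0 : ℝ) 1, ‖deriv (f ∘ γ) s‖ₑ
        ≤ ∫⁻ s in Set.Icc (0 : ℝ) 1, ENNReal.ofReal B * ‖mfderiv 𝓘(ℝ, ℝ) (𝓡 n) γ s (1 : ℝ)‖ₑ := by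
          refine setLIntegral_mono' measurableSet_Icc fun s hs => ?_
          rw [(hder s).deriv, ← ofReal_norm, ← ofReal_norm, ← ENNReal.ofReal_mul hB]
          exact ENNReal.ofReal_le_ofReal (h _ (hmem s hs) _)
      _ = ENNReal.ofReal B * Manifold.pathELength (𝓡 n) γ 0 1 := by
          rw [lintegral_const_mul' _ _ ENNReal.ofReal_ne_top,
            Manifold.pathELength_eq_lintegral_mfderiv_Icc]
          rfl
      _ ≤ ENNReal.ofReal B * ENNReal.ofReal R := by gcongr
      _ = _ := (ENNReal.ofReal_mul hB).symm
  -- `f` is only differentiable, so this derivative need not be continuous. The length bound makes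
  -- it integrable, which suffices for the fundamental theorem of calculus.
  have hint : IntegrableOn (deriv (f ∘ γ)) (Set.Icc 0 1) :=
    ⟨(measurable_deriv _).aestronglyMeasurable, hle.trans_lt ENNReal.ofReal_lt_top⟩
  have hFTC : ∫ s in (0 : ℝ)..1, deriv (f ∘ γ) s = f z - f y := by
    rw [intervalIntegral.integral_eq_sub_of_hasDerivAt
      (fun s _ => (hder s).differentiableAt.hasDerivAt)
      ((intervalIntegrable_iff_integrableOn_Icc_of_le zero_le_one).2 hint)]
    simp [h0, h1]
  rw [norm_sub_rev, ← hFTC, intervalIntegral.integral_of_le zero_le_one,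
    ← integral_Icc_eq_integral_Ioc]
  refine (ENNReal.ofReal_le_ofReal_iff (by positivity)).1 ?_
  rw [ofReal_norm]
  exact (enorm_integral_le_lintegral_enorm _).trans hle

/-! ### The group exp(isT) and its growth in weighted norms. -/

section UnitaryGroup

variable {H : Type*} [NormedAddCommGroup H] [InnerProductSpace ℂ H] [CompleteSpace H]

/-- The unitary group `exp(i s T)`. -/
noncomputable def unitaryGroup (T : H →L[ℂ] H) (s : ℝ) : H →L[ℂ] H :=
  NormedSpace.exp (s • (Complex.I • T))

theorem hasDerivAt_unitaryGroup (T : H →L[ℂ] H) (s : ℝ) :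
    HasDerivAt (unitaryGroup T) (unitaryGroup T s * (Complex.I • T)) s :=
  hasDerivAt_exp_smul_const (𝕂 := ℝ) (Complex.I • T) s

theorem hasDerivAt_unitaryGroup' (T : H →L[ℂ] H) (s : ℝ) :
    HasDerivAt (unitaryGroup T) ((Complex.I • T) * unitaryGroup T s) s :=
  hasDerivAt_exp_smul_const' (𝕂 := ℝ) (Complex.I • T) s

theorem continuous_unitaryGroup (T : H →L[ℂ] H) : Continuous (unitaryGroup T) :=
  continuous_iff_continuousAt.2 fun s => (hasDerivAt_unitaryGroup T s).continuousAt

@[simp]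
theorem unitaryGroup_zero (T : H →L[ℂ] H) : unitaryGroup T 0 = 1 := by
  simp [unitaryGroup]

theorem norm_unitaryGroup_apply {T : H →L[ℂ] H} (hT : IsSelfAdjoint T) (s : ℝ) (f : H) :
    ‖unitaryGroup T s f‖ = ‖f‖ := by
  have hs : IsSelfAdjoint (s • T) := by
    rw [IsSelfAdjoint, star_smul, hT.star_eq, star_trivial]
  have h1 : unitaryGroup T s = (selfAdjoint.expUnitary (⟨s • T, hs⟩ : selfAdjoint (H →L[ℂ] H)) :
      H →L[ℂ] H) := by
    rw [selfAdjoint.expUnitary_coe, unitaryGroup]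
    exact congrArg NormedSpace.exp (ContinuousLinearMap.ext fun x => smul_comm s Complex.I (T x))
  rw [h1]
  exact Unitary.norm_map _ f

theorem unitaryGroup_apply_of_eigen {T : H →L[ℂ] H} {e : H} {c : ℝ} (h : T e = (c : ℂ) • e)
    (s : ℝ) : unitaryGroup T s e = Complex.exp (s * c * Complex.I) • e := by
  -- The curve exp(-iuc) exp(iuT) e has zero derivative, so it keeps its value e at u = 0.
  have hd : ∀ u : ℝ, HasDerivAt (fun u : ℝ => Complex.exp (-(u * c * Complex.I)) •
      unitaryGroup T u e) 0 u := by
    intro u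
    have h1 : HasDerivAt (fun u : ℝ => unitaryGroup T u e)
        ((unitaryGroup T u * (Complex.I • T)) e) u :=
      ((ContinuousLinearMap.apply ℂ H e).restrictScalars ℝ).hasFDerivAt.comp_hasDerivAt u
        (hasDerivAt_unitaryGroup T u)
    have h2 : HasDerivAt (fun u : ℝ => Complex.exp (-(u * c * Complex.I)))
        (Complex.exp (-(u * c * Complex.I)) * -(1 * c * Complex.I)) u := by
      refine HasDerivAt.cexp (HasDerivAt.fun_neg ?_)
      exact ((Complex.ofRealCLM.hasDerivAt (x := u)).mul_const _).mul_const _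
    convert! h2.smul h1 using 1
    simp only [mul_apply_eq_comp, smul_apply, h, map_smul]
    module
  have hc := is_const_of_deriv_eq_zero (fun u => (hd u).differentiableAt)
    (fun u => (hd u).deriv) s 0
  simp only [Complex.ofReal_zero, zero_mul, neg_zero, Complex.exp_zero, one_smul,
    unitaryGroup_zero, one_apply_eq_self] at hc
  conv_rhs => rw [← hc, smul_smul, ← Complex.exp_add, add_neg_cancel, Complex.exp_zero, one_smul]

/-- Polynomial growth in `s` of `exp(i s T)` in a scale of weighted norms whose weights almost
commute with `T`. -/
theorem norm_weight_unitaryGroup_le {T : H →L[ℂ] H} (hT : IsSelfAdjoint T) {W : ℕ → H →L[ℂ] H}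
    (hW0 : W 0 = 1) (hW : ∀ k f, ‖W k f‖ ≤ ‖W (k + 1) f‖) {C : ℝ} (hC : 0 ≤ C) {m : ℕ}
    (hcomm : ∀ k < m, ∀ f, ‖W (k + 1) (T f) - T (W (k + 1) f)‖ ≤ C * ‖W k f‖)
    (f : H) (s : ℝ) : ‖W m (unitaryGroup T s f)‖ ≤ (1 + C * |s|) ^ m * ‖W m f‖ := by
  suffices ∀ k ≤ m, ∀ s, ‖W k (unitaryGroup T s f)‖ ≤ (1 + C * |s|) ^ k * ‖W k f‖ from
    this m le_rfl s
  intro k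
  induction k with
  | zero => intro _ s; simp [hW0, norm_unitaryGroup_apply hT]
  | succ k ih =>
    intro hk s
    have ih' := ih (by omega)
    -- Conjugating the weight by the group turns the derivative into i times a commutator with T.
    -- Its norm is bounded by the weight of order k, where the induction hypothesis applies.
    set φ : ℝ → H := fun u => (unitaryGroup T (-u) * (W (k + 1) * unitaryGroup T u)) f with hφ
    have hd : ∀ u : ℝ, HasDerivAt φ (unitaryGroup T (-u) (Complex.I •
        (W (k + 1) (T (unitaryGroup T u f)) - T (W (k + 1) (unitaryGroup T u f))))) u := by
      intro u
      have h1 : HasDerivAt (fun u : ℝ => unitaryGroup T (-u))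
          (-(unitaryGroup T (-u) * (Complex.I • T))) u := by
        have h := (hasDerivAt_unitaryGroup T (-u)).scomp u (hasDerivAt_neg u)
        rwa [neg_one_smul] at h
      have h2 := h1.mul ((hasDerivAt_unitaryGroup' T u).const_mul (W (k + 1)))
      have h3 := ((ContinuousLinearMap.apply ℂ H f).restrictScalars ℝ).hasFDerivAt.comp_hasDerivAt u
        h2
      convert! h3 using 1
      simp [smul_sub]
      abel
    have hb : ∀ u ∈ Set.Icc (-|s|) |s|, ‖unitaryGroup T (-u) (Complex.I •
        (W (k + 1) (T (unitaryGroup T u f)) - T (W (k + 1) (unitaryGroup T u f))))‖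
        ≤ C * ((1 + C * |s|) ^ k * ‖W k f‖) := by
      intro u hu
      rw [norm_unitaryGroup_apply hT, norm_smul, Complex.norm_I, one_mul]
      refine (hcomm k (by omega) _).trans ?_
      refine mul_le_mul_of_nonneg_left ((ih' u).trans ?_) hC
      have : |u| ≤ |s| := abs_le.2 hu
      gcongr
    have hmv := (convex_Icc (-|s|) |s|).norm_image_sub_le_of_norm_hasDerivWithin_le
      (fun u _ => (hd u).hasDerivWithinAt) hb (x := 0) (y := s)
      ⟨by simp, abs_nonneg s⟩ ⟨neg_abs_le s, le_abs_self s⟩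
    have h0 : φ 0 = W (k + 1) f := by simp [hφ]
    have hs : ‖φ s‖ = ‖W (k + 1) (unitaryGroup T s f)‖ := by
      simp [hφ, norm_unitaryGroup_apply hT]
    rw [h0, sub_zero, Real.norm_eq_abs] at hmv
    rw [← hs]
    have hk1 := hW k f
    have h1le : 1 ≤ (1 + C * |s|) ^ k := one_le_pow₀ (by linarith [mul_nonneg hC (abs_nonneg s)])
    -- Replacing the order k norm of f by the order k + 1 norm lets the two terms combine into one
    -- more factor 1 + C|s|.
    calc ‖φ s‖ ≤ ‖W (k + 1) f‖ + ‖φ s - W (k + 1) f‖ := norm_le_norm_add_norm_sub' _ _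
      _ ≤ (1 + C * |s|) ^ k * ‖W (k + 1) f‖ +
          C * ((1 + C * |s|) ^ k * ‖W (k + 1) f‖) * |s| := by
        refine add_le_add (le_mul_of_one_le_left (norm_nonneg _) h1le) (hmv.trans ?_)
        gcongr
      _ = _ := by ring

end UnitaryGroup

/-! ### Schwartz functional calculus by Fourier inversion. -/

open scoped SchwartzMap FourierTransform

theorem inner_unitaryGroup_of_eigen {H : Type*} [NormedAddCommGroup H] [InnerProductSpace ℂ H]
    [CompleteSpace H] {T : H →L[ℂ] H} (hT : IsSelfAdjoint T) {e : H} {c : ℝ}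
    (h : T e = (c : ℂ) • e) (s : ℝ) (f : H) :
    inner ℂ e (unitaryGroup T s f) = Complex.exp (s * c * Complex.I) * inner ℂ e f := by
  have h1 : inner ℂ (unitaryGroup T s e) (unitaryGroup T s f) = inner ℂ e f :=
    (LinearMap.norm_map_iff_inner_map_map (unitaryGroup T s)).1
      (norm_unitaryGroup_apply hT s) e f
  rw [unitaryGroup_apply_of_eigen h, inner_smul_left, ← Complex.exp_conj] at h1
  rw [← h1, ← mul_assoc, ← Complex.exp_add]
  simp

/-- Smooth functional calculus `v = g(T) f` for a self-adjoint `T`, bounded in the weighted norms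
of a scale of weights which almost commute with `T`. -/
theorem exists_schwartz_functional_calculus (g : 𝓢(ℝ, ℂ)) (m : ℕ) {C : ℝ} (hC : 0 ≤ C) :
    ∃ B : ℝ, 0 ≤ B ∧ ∀ {H : Type*} [NormedAddCommGroup H] [InnerProductSpace ℂ H]
      [CompleteSpace H] (T : H →L[ℂ] H), IsSelfAdjoint T → ∀ W : ℕ → H →L[ℂ] H,
      W 0 = 1 → (∀ k f, ‖W k f‖ ≤ ‖W (k + 1) f‖) →
      (∀ k < m, ∀ f, ‖W (k + 1) (T f) - T (W (k + 1) f)‖ ≤ C * ‖W k f‖) →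
      ∀ f : H, ∃ v : H, ‖W m v‖ ≤ B * ‖W m f‖ ∧
        ∀ (e : H) (c : ℝ), T e = (c : ℂ) • e → inner ℂ e v = g c * inner ℂ e f := by
  -- The bound B will be this integral. It involves only g, m and C, so it is uniform over all
  -- spaces, operators and weights; the rapid decay of the Fourier transform beats the polynomial
  -- growth of the group.
  have hint : Integrable fun s : ℝ => ‖𝓕 g s‖ * (1 + C * |2 * Real.pi * s|) ^ m := by
    have : (fun s : ℝ => ‖𝓕 g s‖ * (1 + C * |2 * Real.pi * s|) ^ m) = fun s : ℝ =>
        ∑ k ∈ Finset.range (m + 1), ((C * (2 * Real.pi)) ^ k * m.choose k) *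
          (‖s‖ ^ k * ‖𝓕 g s‖) := by
      ext s
      rw [add_comm, add_pow, Finset.mul_sum]
      refine Finset.sum_congr rfl fun k _ => ?_
      rw [abs_mul, abs_of_pos (by positivity : 0 < 2 * Real.pi), Real.norm_eq_abs]
      ring
    rw [this]
    exact integrable_finsetSum _ fun k _ => ((𝓕 g).integrable_pow_mul volume k).const_mul _
  refine ⟨∫ s, ‖𝓕 g s‖ * (1 + C * |2 * Real.pi * s|) ^ m, integral_nonneg fun s => by positivity,
    fun {H} _ _ _ T hT W hW0 hW hcomm f => ?_⟩
  have hcont : Continuous fun s : ℝ => unitaryGroup T (2 * Real.pi * s) f :=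
    ((continuous_unitaryGroup T).comp (by fun_prop)).clm_apply continuous_const
  have hvint : Integrable fun s : ℝ => 𝓕 g s • unitaryGroup T (2 * Real.pi * s) f := by
    refine ((𝓕 g).integrable.norm.mul_const ‖f‖).mono'
      ((𝓕 g).continuous.smul hcont).aestronglyMeasurable (ae_of_all _ fun s => ?_)
    rw [norm_smul, norm_unitaryGroup_apply hT]
  -- This is g(T) f written by Fourier inversion; the factor 2π matches Mathlib's normalisation of
  -- the Fourier transform.
  refine ⟨∫ s, 𝓕 g s • unitaryGroup T (2 * Real.pi * s) f, ?_, fun e c he => ?_⟩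
  · rw [← ContinuousLinearMap.integral_comp_comm _ hvint, ← integral_mul_const]
    refine norm_integral_le_of_norm_le (hint.mul_const _) (ae_of_all _ fun s => ?_)
    rw [map_smul, norm_smul, mul_assoc ‖𝓕 g s‖]
    gcongr
    exact norm_weight_unitaryGroup_le hT hW0 hW hC hcomm f _
  · have h1 : inner ℂ e (∫ s, 𝓕 g s • unitaryGroup T (2 * Real.pi * s) f) =
        ∫ s, inner ℂ e (𝓕 g s • unitaryGroup T (2 * Real.pi * s) f) :=
      (integral_inner hvint e).symm
    have h2 : 𝓕⁻ (𝓕 g) c = g c := by rw [FourierTransform.fourierInv_fourier_eq]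
    rw [h1, ← h2, SchwartzMap.fourierInv_coe, Real.fourierInv_eq', ← integral_mul_const]
    refine integral_congr_ae (ae_of_all _ fun s => ?_)
    simp only [inner_smul_right, inner_unitaryGroup_of_eigen hT he, smul_eq_mul]
    rw [← mul_assoc, mul_comm (𝓕 g s)]
    congr 3
    simp only [Inner.inner]
    push_cast
    simp
    ring

/-- A Schwartz function equal to `λ⁻²` on `[a, 1]`. -/
theorem exists_schwartz_eq_inv_sq {a : ℝ} (ha : 0 < a) (ha1 : a ≤ 1) :
    ∃ g : 𝓢(ℝ, ℂ), ∀ c ∈ Set.Icc a 1, g c = ((c : ℂ) ^ 2)⁻¹ := by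
  -- The bump equals 1 on [3a/4, 1 + a/4] and is supported in [a/2, 1 + a/2], away from the pole at
  -- 0.
  let b : ContDiffBump ((a + 1) / 2 : ℝ) := ⟨(1 - a) / 2 + a / 4, (1 - a) / 2 + a / 2,
    by linarith, by linarith⟩
  have hsm : ContDiff ℝ ∞ fun x : ℝ => ((b x : ℝ) : ℂ) * ((x : ℂ) ^ 2)⁻¹ := by
    have hb : ContDiff ℝ ∞ fun x : ℝ => ((b x : ℝ) : ℂ) :=
      Complex.ofRealCLM.contDiff.comp b.contDiff
    refine contDiff_iff_contDiffAt.2 fun x => ?_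
    rcases eq_or_ne x 0 with rfl | hx
    · have h0 : (0 : ℝ) ∉ tsupport b := by
        rw [b.tsupport_eq, Metric.mem_closedBall, Real.dist_eq, zero_sub, abs_neg,
          abs_of_pos (by linarith)]
        change ¬ (a + 1) / 2 ≤ (1 - a) / 2 + a / 2
        linarith
      have h1 := notMem_tsupport_iff_eventuallyEq.1 h0
      refine (contDiffAt_const (c := (0 : ℂ))).congr_of_eventuallyEq ?_
      filter_upwards [h1] with y hy
      simp [hy]
    · refine hb.contDiffAt.mul (ContDiffAt.inv ?_ (by simpa using hx))
      exact (Complex.ofRealCLM.contDiff.contDiffAt).pow 2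
  have hcs : HasCompactSupport fun x : ℝ => ((b x : ℝ) : ℂ) * ((x : ℂ) ^ 2)⁻¹ := by
    refine HasCompactSupport.mul_right ?_
    exact b.hasCompactSupport.comp_left (g := fun y : ℝ => (y : ℂ)) Complex.ofReal_zero
  refine ⟨hcs.toSchwartzMap hsm, fun c hc => ?_⟩
  have : b c = 1 := b.one_of_mem_closedBall <| by
    rw [Metric.mem_closedBall, Real.dist_eq]
    change _ ≤ (1 - a) / 2 + a / 4
    rw [abs_le]
    constructor <;> linarith [hc.1, hc.2]
  simp [this]

/-! ### Integral and multiplication operators on L²(μ). -/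

section IntegralOperators

variable {X : Type*} [MeasurableSpace X] {μ : Measure X}

theorem sq_lintegral_mul_le {f g : X → ℝ≥0∞} (hf : AEMeasurable f μ) (hg : AEMeasurable g μ) :
    (∫⁻ x, f x * g x ∂μ) ^ 2 ≤ (∫⁻ x, f x ^ 2 ∂μ) * ∫⁻ x, g x ^ 2 ∂μ := by
  have h := ENNReal.lintegral_mul_le_Lp_mul_Lq μ Real.HolderConjugate.two_two hf hg
  have h2 := pow_le_pow_left' h 2
  simp only [Pi.mul_apply] at h2
  refine h2.trans_eq ?_
  rw [mul_pow, ← ENNReal.rpow_natCast, ← ENNReal.rpow_natCast, ← ENNReal.rpow_mul,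
    ← ENNReal.rpow_mul]
  norm_num

theorem enorm_sq_eq_lintegral (f : Lp ℂ 2 μ) : ‖f‖ₑ ^ 2 = ∫⁻ x, ‖f x‖ₑ ^ 2 ∂μ := by
  have h := eLpNorm_nnreal_pow_eq_lintegral (f := f) (μ := μ) (p := 2) two_ne_zero
  rw [Lp.enorm_def]
  simpa using h

theorem norm_le_mul_of_enorm_le {f : Lp ℂ 2 μ} {F : X → ℝ} {B : ℝ} (hB : 0 ≤ B)
    (hF : ∀ᵐ x ∂μ, ‖f x‖ ≤ F x) (hB' : ∫⁻ x, ENNReal.ofReal (F x) ^ 2 ∂μ ≤ ENNReal.ofReal (B ^ 2)) :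
    ‖f‖ ≤ B := by
  have h : ‖f‖ₑ ^ 2 ≤ ENNReal.ofReal (B ^ 2) := by
    rw [enorm_sq_eq_lintegral]
    refine (lintegral_mono_ae ?_).trans hB'
    filter_upwards [hF] with x hx
    rw [← ofReal_norm]
    gcongr
  rw [← ofReal_norm, ← ENNReal.ofReal_pow (norm_nonneg _),
    ENNReal.ofReal_le_ofReal_iff (by positivity)] at h
  exact (sq_le_sq₀ (norm_nonneg _) hB).1 h

/-- Schur's test. -/
theorem norm_le_of_schur [SFinite μ] {J : X → X → ℝ≥0∞} (hJ : Measurable (Function.uncurry J))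
    {A : ℝ} (hA : 0 ≤ A) (h1 : ∀ y, ∫⁻ z, J y z ∂μ ≤ ENNReal.ofReal A)
    (h2 : ∀ z, ∫⁻ y, J y z ∂μ ≤ ENNReal.ofReal A) {f g : Lp ℂ 2 μ}
    (h : ∀ᵐ y ∂μ, ‖g y‖ₑ ≤ ∫⁻ z, J y z * ‖f z‖ₑ ∂μ) : ‖g‖ ≤ A * ‖f‖ := by
  have hfm : Measurable fun z => ‖f z‖ₑ := (Lp.stronglyMeasurable f).measurable.enorm
  have hJy : ∀ y, Measurable (J y) := fun y => hJ.comp measurable_prodMk_left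
  have key : ‖g‖ₑ ^ 2 ≤ ENNReal.ofReal A ^ 2 * ‖f‖ₑ ^ 2 := by
    rw [enorm_sq_eq_lintegral, enorm_sq_eq_lintegral]
    calc ∫⁻ y, ‖g y‖ₑ ^ 2 ∂μ
        ≤ ∫⁻ y, ENNReal.ofReal A * ∫⁻ z, J y z * ‖f z‖ₑ ^ 2 ∂μ ∂μ := by
          refine lintegral_mono_ae ?_
          filter_upwards [h] with y hy
          refine (pow_le_pow_left' hy 2).trans ?_
          -- Writing J as the square of its root and applying Cauchy–Schwarz leaves one plain row
          -- integral of J and one weighted by |f|².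
          have hs : ∀ z, J y z = J y z ^ (2⁻¹ : ℝ) * J y z ^ (2⁻¹ : ℝ) := fun z => by
            rw [← ENNReal.rpow_add_of_nonneg _ _ (by norm_num) (by norm_num)]
            norm_num
          have hs' : ∀ z, (J y z ^ (2⁻¹ : ℝ)) ^ 2 = J y z := fun z => by
            rw [sq, ← hs]
          have hm : Measurable fun z => J y z ^ (2⁻¹ : ℝ) := (hJy y).pow_const _
          calc (∫⁻ z, J y z * ‖f z‖ₑ ∂μ) ^ 2
              = (∫⁻ z, J y z ^ (2⁻¹ : ℝ) * (J y z ^ (2⁻¹ : ℝ) * ‖f z‖ₑ) ∂μ) ^ 2 := by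
                simp_rw [← mul_assoc, ← hs]
            _ ≤ _ := sq_lintegral_mul_le hm.aemeasurable (hm.mul hfm).aemeasurable
            _ ≤ _ := by
                simp_rw [mul_pow, hs']
                gcongr
                exact h1 y
      _ = ENNReal.ofReal A * ∫⁻ z, ∫⁻ y, J y z * ‖f z‖ₑ ^ 2 ∂μ ∂μ := by
          rw [lintegral_const_mul' _ _ ENNReal.ofReal_ne_top, lintegral_lintegral_swap]
          exact (hJ.mul ((hfm.comp measurable_snd).pow_const 2)).aemeasurable
      _ ≤ ENNReal.ofReal A * ∫⁻ z, ENNReal.ofReal A * ‖f z‖ₑ ^ 2 ∂μ := by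
          gcongr with z
          have hJz : Measurable fun y => J y z := hJ.comp measurable_prodMk_right
          rw [lintegral_mul_const _ hJz]
          gcongr
          exact h2 z
      _ = _ := by
          rw [lintegral_const_mul' _ _ ENNReal.ofReal_ne_top, sq, mul_assoc]
  rw [← mul_pow, ← ofReal_norm, ← ofReal_norm, ← ENNReal.ofReal_mul hA,
    ← ENNReal.ofReal_pow (norm_nonneg _), ← ENNReal.ofReal_pow (by positivity),
    ENNReal.ofReal_le_ofReal_iff (by positivity)] at key
  exact (sq_le_sq₀ (norm_nonneg _) (by positivity)).1 key

theorem integrable_bounded_mul [IsFiniteMeasure μ] {k : X → ℂ} (hk : Measurable k) {B : ℝ}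
    (hB : ∀ x, ‖k x‖ ≤ B) (f : Lp ℂ 2 μ) : Integrable (fun x => k x * f x) μ :=
  ((Lp.memLp f).integrable one_le_two).bdd_mul hk.aestronglyMeasurable (ae_of_all _ hB)

/-- The integral operator on `L²(μ)` with a bounded measurable kernel. -/
theorem exists_integralOperator [IsProbabilityMeasure μ] {K : X → X → ℂ}
    (hK : Measurable (Function.uncurry K)) {B : ℝ} (hB : ∀ x y, ‖K x y‖ ≤ B) :
    ∃ T : Lp ℂ 2 μ →L[ℂ] Lp ℂ 2 μ, ∀ f, T f =ᵐ[μ] fun y => ∫ z, K y z * f z ∂μ := by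
  have hKy : ∀ y, Measurable (K y) := fun y => hK.comp measurable_prodMk_left
  have hi : ∀ y (f : Lp ℂ 2 μ), Integrable (fun z => K y z * f z) μ := fun y f =>
    integrable_bounded_mul (hKy y) (hB y) f
  have hbd : ∀ (f : Lp ℂ 2 μ) y, ‖∫ z, K y z * f z ∂μ‖ ≤ B * ‖f‖ := by
    intro f y
    have hB0 : 0 ≤ B := (norm_nonneg _).trans (hB y y)
    have h1 : ∫ z, ‖f z‖ ∂μ ≤ ‖f‖ := by
      have h2 : eLpNorm f 1 μ ≤ eLpNorm f 2 μ :=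
        eLpNorm_le_eLpNorm_of_exponent_le one_le_two (Lp.aestronglyMeasurable f)
      rw [integral_norm_eq_lintegral_enorm (Lp.aestronglyMeasurable f),
        ← eLpNorm_one_eq_lintegral_enorm, Lp.norm_def]
      exact ENNReal.toReal_mono (Lp.eLpNorm_ne_top f) h2
    calc ‖∫ z, K y z * f z ∂μ‖ ≤ ∫ z, B * ‖f z‖ ∂μ := by
          refine norm_integral_le_of_norm_le
            (((Lp.memLp f).integrable one_le_two).norm.const_mul B) (ae_of_all _ fun z => ?_)
          rw [norm_mul]
          gcongr
          exact hB y z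
      _ = B * ∫ z, ‖f z‖ ∂μ := integral_const_mul _ _
      _ ≤ _ := by gcongr
  have hm : ∀ f : Lp ℂ 2 μ, AEStronglyMeasurable (fun y => ∫ z, K y z * f z ∂μ) μ := by
    intro f
    refine (StronglyMeasurable.integral_prod_right' (f := fun q : X × X => K q.1 q.2 * f q.2)
      ?_).aestronglyMeasurable
    exact (hK.mul ((Lp.stronglyMeasurable f).measurable.comp measurable_snd)).stronglyMeasurable
  have hL : ∀ f : Lp ℂ 2 μ, MemLp (fun y => ∫ z, K y z * f z ∂μ) 2 μ := fun f =>
    MemLp.of_bound (hm f) _ (ae_of_all _ (hbd f))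
  let T₀ : Lp ℂ 2 μ →ₗ[ℂ] Lp ℂ 2 μ :=
    { toFun := fun f => (hL f).toLp _
      map_add' := fun f g => by
        rw [← MemLp.toLp_add]
        refine MemLp.toLp_congr _ _ (ae_of_all _ fun y => ?_)
        rw [Pi.add_apply, ← integral_add (hi y f) (hi y g)]
        refine integral_congr_ae ?_
        filter_upwards [Lp.coeFn_add f g] with z hz
        rw [hz, Pi.add_apply, mul_add]
      map_smul' := fun c f => by
        rw [RingHom.id_apply, ← MemLp.toLp_const_smul]
        refine MemLp.toLp_congr _ _ (ae_of_all _ fun y => ?_)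
        rw [Pi.smul_apply, ← integral_smul]
        refine integral_congr_ae ?_
        filter_upwards [Lp.coeFn_smul c f] with z hz
        rw [hz, Pi.smul_apply, smul_eq_mul, smul_eq_mul]
        ring }
  refine ⟨T₀.mkContinuous |B| fun f => ?_, fun f => ?_⟩
  · refine (Lp.norm_le_of_ae_bound (C := |B| * ‖f‖) (by positivity) ?_).trans_eq ?_
    · filter_upwards [(hL f).coeFn_toLp] with y hy
      change ‖((hL f).toLp _) y‖ ≤ _
      rw [hy]
      refine (hbd f y).trans ?_
      gcongr
      exact le_abs_self B
    · simp [measureUnivNNReal]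
  · exact (hL f).coeFn_toLp

theorem isSelfAdjoint_of_hermitian_kernel [IsProbabilityMeasure μ] {K : X → X → ℂ}
    (hK : Measurable (Function.uncurry K)) {B : ℝ} (hB : ∀ x y, ‖K x y‖ ≤ B)
    (hsymm : ∀ x y, (starRingEnd ℂ) (K x y) = K y x) {T : Lp ℂ 2 μ →L[ℂ] Lp ℂ 2 μ}
    (hT : ∀ f, T f =ᵐ[μ] fun y => ∫ z, K y z * f z ∂μ) : IsSelfAdjoint T := by
  rw [ContinuousLinearMap.isSelfAdjoint_iff_isSymmetric]
  intro f g
  have hint : Integrable (fun q : X × X => K q.1 q.2 * (g q.2 * (starRingEnd ℂ) (f q.1)))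
      (μ.prod μ) := by
    have h1 : Integrable (fun q : X × X => (starRingEnd ℂ) (f q.1) * g q.2) (μ.prod μ) :=
      Integrable.mul_prod
        (((Lp.memLp f).star).integrable one_le_two) ((Lp.memLp g).integrable one_le_two)
    refine Integrable.bdd_mul (c := B) ?_ hK.aestronglyMeasurable (ae_of_all _ fun q => hB _ _)
    simpa only [mul_comm] using h1
  calc inner ℂ (T f) g = ∫ y, (∫ z, K z y * (g y * (starRingEnd ℂ) (f z)) ∂μ) ∂μ := by
        rw [L2.inner_def]
        refine integral_congr_ae ?_
        filter_upwards [hT f] with y hy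
        rw [hy, RCLike.inner_apply, ← integral_conj, ← integral_const_mul]
        refine integral_congr_ae (ae_of_all _ fun z => ?_)
        simp only [map_mul, hsymm]
        ring
    _ = ∫ z, (∫ y, K z y * (g y * (starRingEnd ℂ) (f z)) ∂μ) ∂μ :=
        (integral_integral_swap hint).symm
    _ = inner ℂ f (T g) := by
        rw [L2.inner_def]
        refine integral_congr_ae ?_
        filter_upwards [hT g] with y hy
        rw [hy, RCLike.inner_apply, ← integral_mul_const]
        refine integral_congr_ae (ae_of_all _ fun z => ?_)
        simp only
        ring

/-- Multiplication by a bounded measurable function on `L²(μ)`. -/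
theorem exists_mulOperator {b : X → ℝ} (hb : Measurable b) {B : ℝ} (hB : ∀ x, |b x| ≤ B) :
    ∃ W : Lp ℂ 2 μ →L[ℂ] Lp ℂ 2 μ, ∀ f, W f =ᵐ[μ] fun y => (b y : ℂ) * f y := by
  have hb' : MemLp (fun x => (b x : ℂ)) ∞ μ :=
    memLp_top_of_bound (Complex.measurable_ofReal.comp hb).aestronglyMeasurable B
      (ae_of_all _ fun x => by simpa using hB x)
  refine ⟨(ContinuousLinearMap.mul ℂ ℂ).holderL μ ∞ 2 2 (hb'.toLp _), fun f => ?_⟩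
  refine ((ContinuousLinearMap.mul ℂ ℂ).coeFn_holder (hb'.toLp _) f).trans ?_
  filter_upwards [hb'.coeFn_toLp] with y hy
  rw [hy]
  rfl

end IntegralOperators

/-! ### Convergence, eigenfunctions and the semigroup identity for the heat kernel. -/

section HeatKernel

variable {X : Type*}

theorem conj_heatKernel (φ : ℕ → X → ℂ) (ℓ : ℕ → ℝ) (t : ℝ) (x y : X) :
    (starRingEnd ℂ) (heatKernel φ ℓ t x y) = heatKernel φ ℓ t y x := by
  rw [heatKernel, heatKernel, Complex.conj_tsum]
  refine tsum_congr fun k => ?_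
  simp only [map_mul, Complex.conj_conj, Complex.conj_ofReal]
  ring

theorem heatKernel_diag_eq (φ : ℕ → X → ℂ) (ℓ : ℕ → ℝ) (t : ℝ) (x : X) :
    heatKernel φ ℓ t x x = ((∑' k, Real.exp (-(ℓ k) ^ 2 * t) * ‖φ k x‖ ^ 2 : ℝ) : ℂ) := by
  rw [heatKernel, Complex.ofReal_tsum]
  refine tsum_congr fun k => ?_
  rw [mul_assoc, Complex.mul_conj, Complex.normSq_eq_norm_sq]
  push_cast
  ring

theorem norm_heatKernel_term_le (φ : ℕ → X → ℂ) (ℓ : ℕ → ℝ) (t : ℝ) (x y : X) (k : ℕ) :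
    ‖(Real.exp (-(ℓ k) ^ 2 * t) : ℂ) * φ k x * (starRingEnd ℂ) (φ k y)‖ ≤
      (Real.exp (-(ℓ k) ^ 2 * t) * ‖φ k x‖ ^ 2 + Real.exp (-(ℓ k) ^ 2 * t) * ‖φ k y‖ ^ 2) / 2 := by
  rw [norm_mul, norm_mul, RCLike.norm_conj, Complex.norm_real, Real.norm_eq_abs, Real.abs_exp]
  nlinarith [mul_nonneg (Real.exp_pos (-(ℓ k) ^ 2 * t)).le (sq_nonneg (‖φ k x‖ - ‖φ k y‖))]

variable [MetricSpace X] {α κ₂ κ₃ κ₄ : ℝ} {φ : ℕ → X → ℂ} {ℓ : ℕ → ℝ} {t : ℝ}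

/-- The Gaussian upper bound and the diagonal lower bound for the heat kernel. -/
structure GaussianBounds (α κ₂ κ₃ κ₄ : ℝ) (φ : ℕ → X → ℂ) (ℓ : ℕ → ℝ) : Prop where
  upper : ∀ t : ℝ, 0 < t → t ≤ 1 → ∀ x y : X,
    ‖heatKernel φ ℓ t x y‖ ≤ κ₂ * t ^ (-α / 2) * Real.exp (-κ₃ * dist x y ^ 2 / t)
  lower : ∀ t : ℝ, 0 < t → t ≤ 1 → ∀ x : X,
    κ₄ * t ^ (-α / 2) ≤ (heatKernel φ ℓ t x x).re

namespace GaussianBounds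

/-- A divergent diagonal series would have the default sum 0, contradicting the positive lower
bound. -/
theorem summable_diag (h : GaussianBounds α κ₂ κ₃ κ₄ φ ℓ) (hκ₄ : 0 < κ₄) (ht : 0 < t)
    (ht1 : t ≤ 1) (x : X) : Summable fun k => Real.exp (-(ℓ k) ^ 2 * t) * ‖φ k x‖ ^ 2 := by
  by_contra hns
  have h1 := h.lower t ht ht1 x
  rw [heatKernel_diag_eq, tsum_eq_zero_of_not_summable hns] at h1
  have : 0 < κ₄ * t ^ (-α / 2) := by positivity
  simp at h1
  linarith

theorem norm_le (h : GaussianBounds α κ₂ κ₃ κ₄ φ ℓ) (hκ₂ : 0 < κ₂) (hκ₃ : 0 < κ₃) (ht : 0 < t)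
    (ht1 : t ≤ 1) (x y : X) : ‖heatKernel φ ℓ t x y‖ ≤ κ₂ * t ^ (-α / 2) := by
  refine (h.upper t ht ht1 x y).trans (mul_le_of_le_one_right (by positivity) ?_)
  rw [Real.exp_le_one_iff, neg_mul, neg_div]
  exact neg_nonpos.2 (by positivity)

theorem tsum_diag_le (h : GaussianBounds α κ₂ κ₃ κ₄ φ ℓ) (hκ₂ : 0 < κ₂) (hκ₃ : 0 < κ₃)
    (ht : 0 < t) (ht1 : t ≤ 1) (x : X) :
    ∑' k, Real.exp (-(ℓ k) ^ 2 * t) * ‖φ k x‖ ^ 2 ≤ κ₂ * t ^ (-α / 2) := by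
  have h1 := h.norm_le hκ₂ hκ₃ ht ht1 x x
  rw [heatKernel_diag_eq, Complex.norm_real] at h1
  exact (le_abs_self _).trans h1

theorem summable (h : GaussianBounds α κ₂ κ₃ κ₄ φ ℓ) (hκ₄ : 0 < κ₄) (ht : 0 < t)
    (ht1 : t ≤ 1) (x y : X) :
    Summable fun k => (Real.exp (-(ℓ k) ^ 2 * t) : ℂ) * φ k x * (starRingEnd ℂ) (φ k y) :=
  Summable.of_norm_bounded
    (((h.summable_diag hκ₄ ht ht1 x).add (h.summable_diag hκ₄ ht ht1 y)).div_const 2)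
    (norm_heatKernel_term_le φ ℓ t x y)

/-- The diagonal series has nonnegative terms, so its partial sums stay below the kernel bound, and
the arithmetic-geometric mean inequality carries this off the diagonal. It supplies the dominating
constant for termwise integration. -/
theorem norm_sum_le (h : GaussianBounds α κ₂ κ₃ κ₄ φ ℓ) (hκ₂ : 0 < κ₂) (hκ₃ : 0 < κ₃)
    (hκ₄ : 0 < κ₄) (ht : 0 < t) (ht1 : t ≤ 1) (x y : X) (s : Finset ℕ) :
    ‖∑ k ∈ s, (Real.exp (-(ℓ k) ^ 2 * t) : ℂ) * φ k x * (starRingEnd ℂ) (φ k y)‖ ≤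
      κ₂ * t ^ (-α / 2) := by
  have hs : ∀ x, ∑ k ∈ s, Real.exp (-(ℓ k) ^ 2 * t) * ‖φ k x‖ ^ 2 ≤ κ₂ * t ^ (-α / 2) := fun x =>
    ((h.summable_diag hκ₄ ht ht1 x).sum_le_tsum s fun k _ => by positivity).trans
      (h.tsum_diag_le hκ₂ hκ₃ ht ht1 x)
  refine (norm_sum_le_of_le s fun k _ => norm_heatKernel_term_le φ ℓ t x y k).trans ?_
  rw [← Finset.sum_div, Finset.sum_add_distrib]
  linarith [hs x, hs y]

theorem tendsto_sum (h : GaussianBounds α κ₂ κ₃ κ₄ φ ℓ) (hκ₄ : 0 < κ₄) (ht : 0 < t)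
    (ht1 : t ≤ 1) (x y : X) :
    Tendsto (fun N => ∑ k ∈ Finset.range N,
      (Real.exp (-(ℓ k) ^ 2 * t) : ℂ) * φ k x * (starRingEnd ℂ) (φ k y)) atTop
      (nhds (heatKernel φ ℓ t x y)) :=
  (h.summable hκ₄ ht ht1 x y).hasSum.tendsto_sum_nat

variable [CompactSpace X] [MeasurableSpace X] [BorelSpace X] {μ : Measure X}

theorem measurable (h : GaussianBounds α κ₂ κ₃ κ₄ φ ℓ) (hφ : ∀ k, Continuous (φ k))
    (hκ₄ : 0 < κ₄) (ht : 0 < t) (ht1 : t ≤ 1) :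
    Measurable (Function.uncurry (heatKernel φ ℓ t)) := by
  refine measurable_of_tendsto_metrizable (f := fun N (q : X × X) => ∑ k ∈ Finset.range N,
    (Real.exp (-(ℓ k) ^ 2 * t) : ℂ) * φ k q.1 * (starRingEnd ℂ) (φ k q.2)) (fun N => ?_)
    (tendsto_pi_nhds.2 fun q => h.tendsto_sum hκ₄ ht ht1 q.1 q.2)
  refine Continuous.measurable ?_
  refine continuous_finsetSum _ fun k _ => ?_
  have := hφ k
  fun_prop

theorem tendsto_integral [IsProbabilityMeasure μ] (h : GaussianBounds α κ₂ κ₃ κ₄ φ ℓ)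
    (hφ : ∀ k, Continuous (φ k)) (hκ₂ : 0 < κ₂) (hκ₃ : 0 < κ₃) (hκ₄ : 0 < κ₄) (ht : 0 < t)
    (ht1 : t ≤ 1) {f : X → ℂ} (hf : Measurable f) {B : ℝ} (hB : ∀ x, ‖f x‖ ≤ B) (x : X) :
    Tendsto (fun N => ∑ k ∈ Finset.range N, (Real.exp (-(ℓ k) ^ 2 * t) : ℂ) * φ k x *
      ∫ y, f y * (starRingEnd ℂ) (φ k y) ∂μ) atTop
      (nhds (∫ y, heatKernel φ ℓ t x y * f y ∂μ)) := by
  have hi : ∀ k, Integrable (fun y => f y * (starRingEnd ℂ) (φ k y)) μ := fun k => by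
    have hc : Continuous fun y => (starRingEnd ℂ) (φ k y) := Complex.continuous_conj.comp (hφ k)
    exact (hc.integrable_of_hasCompactSupport (HasCompactSupport.of_compactSpace _)).bdd_mul
      hf.aestronglyMeasurable (ae_of_all _ hB)
  have heq : ∀ N, ∑ k ∈ Finset.range N, (Real.exp (-(ℓ k) ^ 2 * t) : ℂ) * φ k x *
      ∫ y, f y * (starRingEnd ℂ) (φ k y) ∂μ = ∫ y, (∑ k ∈ Finset.range N,
        (Real.exp (-(ℓ k) ^ 2 * t) : ℂ) * φ k x * (starRingEnd ℂ) (φ k y)) * f y ∂μ := by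
    intro N
    simp_rw [Finset.sum_mul, ← integral_const_mul]
    rw [← integral_finsetSum _ fun k _ => (hi k).const_mul _]
    refine integral_congr_ae (ae_of_all _ fun y => Finset.sum_congr rfl fun k _ => ?_)
    ring
  simp_rw [heq]
  refine tendsto_integral_of_dominated_convergence (fun _ => κ₂ * t ^ (-α / 2) * B) (fun N => ?_)
    (integrable_const _) (fun N => ae_of_all _ fun y => ?_) (ae_of_all _ fun y => ?_)
  · refine (Measurable.mul (Continuous.measurable ?_) hf).aestronglyMeasurable
    refine continuous_finsetSum _ fun k _ => ?_
    have := hφ k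
    fun_prop
  · rw [norm_mul]
    exact mul_le_mul (h.norm_sum_le hκ₂ hκ₃ hκ₄ ht ht1 x y _) (hB y) (norm_nonneg _)
      (by positivity)
  · exact (h.tendsto_sum hκ₄ ht ht1 x y).mul_const _

theorem integral_heatKernel_mul_phi [IsProbabilityMeasure μ] (h : GaussianBounds α κ₂ κ₃ κ₄ φ ℓ)
    (hs : IsOrthonormalSystem μ φ ℓ) (hκ₂ : 0 < κ₂) (hκ₃ : 0 < κ₃) (hκ₄ : 0 < κ₄) (ht : 0 < t)
    (ht1 : t ≤ 1) (j : ℕ) (x : X) :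
    ∫ y, heatKernel φ ℓ t x y * φ j y ∂μ = (Real.exp (-(ℓ j) ^ 2 * t) : ℂ) * φ j x := by
  obtain ⟨B, hB⟩ := isCompact_univ.exists_bound_of_continuousOn (hs.continuous j).continuousOn
  refine tendsto_nhds_unique (h.tendsto_integral hs.continuous hκ₂ hκ₃ hκ₄ ht ht1
    (hs.continuous j).measurable (fun y => hB y trivial) x) ?_
  refine tendsto_const_nhds.congr' ?_
  filter_upwards [eventually_gt_atTop j] with N hN
  simp_rw [hs.orthonormal, mul_ite, mul_one, mul_zero]
  rw [Finset.sum_ite_eq, if_pos (Finset.mem_range.2 hN)]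

/-- This is the semigroup law on the diagonal: expand one factor in the orthonormal system and use
the eigenfunction identity for the other. It converts the lower bound at time 2t into an L² lower
bound at time t. -/
theorem integral_norm_sq [IsProbabilityMeasure μ] (h : GaussianBounds α κ₂ κ₃ κ₄ φ ℓ)
    (hs : IsOrthonormalSystem μ φ ℓ) (hκ₂ : 0 < κ₂) (hκ₃ : 0 < κ₃) (hκ₄ : 0 < κ₄) (ht : 0 < t)
    (ht1 : 2 * t ≤ 1) (x : X) :
    ∫ y, ‖heatKernel φ ℓ t x y‖ ^ 2 ∂μ = (heatKernel φ ℓ (2 * t) x x).re := by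
  have ht1' : t ≤ 1 := by linarith
  have hm : Measurable fun y => heatKernel φ ℓ t y x :=
    (h.measurable hs.continuous hκ₄ ht ht1').comp measurable_prodMk_right
  have h1 := h.tendsto_integral (μ := μ) hs.continuous hκ₂ hκ₃ hκ₄ ht ht1' hm
    (fun y => h.norm_le hκ₂ hκ₃ ht ht1' y x) x
  have h2 := h.tendsto_sum hκ₄ (by positivity) ht1 x x
  have h3 : ∀ k, ∫ y, heatKernel φ ℓ t y x * (starRingEnd ℂ) (φ k y) ∂μ =
      (Real.exp (-(ℓ k) ^ 2 * t) : ℂ) * (starRingEnd ℂ) (φ k x) := by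
    intro k
    have h4 := congrArg (starRingEnd ℂ)
      (h.integral_heatKernel_mul_phi hs hκ₂ hκ₃ hκ₄ ht ht1' k x)
    rw [← integral_conj, map_mul, Complex.conj_ofReal] at h4
    simpa only [map_mul, conj_heatKernel] using h4
  have h5 : ∫ y, heatKernel φ ℓ t x y * heatKernel φ ℓ t y x ∂μ = heatKernel φ ℓ (2 * t) x x := by
    refine tendsto_nhds_unique h1 (h2.congr fun N => Finset.sum_congr rfl fun k _ => ?_)
    rw [h3, two_mul, mul_add, Real.exp_add]
    push_cast
    ring
  rw [← h5, ← RCLike.re_eq_complex_re, ← integral_re]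
  · refine integral_congr_ae (ae_of_all _ fun y => ?_)
    simp only
    rw [← conj_heatKernel φ ℓ t x y, RCLike.mul_conj]
    norm_cast
  · refine Integrable.of_bound (C := (κ₂ * t ^ (-α / 2)) * (κ₂ * t ^ (-α / 2))) ?_
      (ae_of_all _ fun y => ?_)
    · exact (((h.measurable hs.continuous hκ₄ ht ht1').comp
        measurable_prodMk_left).mul hm).aestronglyMeasurable
    · rw [norm_mul]
      exact mul_le_mul (h.norm_le hκ₂ hκ₃ ht ht1' _ _) (h.norm_le hκ₂ hκ₃ ht ht1' _ _)
        (norm_nonneg _) (by positivity)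

end GaussianBounds

end HeatKernel

/-! ### The polynomial weight at scale r and Gaussian decay measured by it. -/

/-- The weight `1 + ρ(x, y) / r`. -/
noncomputable def locWeight {X : Type*} [MetricSpace X] (r : ℝ) (x y : X) : ℝ := 1 + dist x y / r

section Weight

variable {X : Type*} [MetricSpace X] {r : ℝ}

theorem one_le_locWeight (hr : 0 < r) (x y : X) : 1 ≤ locWeight r x y :=
  le_add_of_nonneg_right (by positivity)

theorem locWeight_pos (hr : 0 < r) (x y : X) : 0 < locWeight r x y :=
  zero_lt_one.trans_le (one_le_locWeight hr x y)

theorem locWeight_comm (r : ℝ) (x y : X) : locWeight r x y = locWeight r y x := by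
  rw [locWeight, locWeight, dist_comm]

theorem locWeight_le_mul (hr : 0 < r) (x y z : X) :
    locWeight r x z ≤ locWeight r x y * locWeight r y z := by
  have h1 : dist x z / r ≤ dist x y / r + dist y z / r := by
    rw [← add_div]
    exact div_le_div_of_nonneg_right (dist_triangle x y z) hr.le
  have h2 : 0 ≤ dist x y / r * (dist y z / r) := by positivity
  unfold locWeight
  linarith [mul_add (1 + dist x y / r) 1 (dist y z / r), add_mul 1 (dist x y / r) (dist y z / r)]

theorem locWeight_le_of_dist_le (hr : 0 < r) {a : ℝ} {x y : X} (h : dist x y ≤ a * r) :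
    locWeight r x y ≤ 1 + a := by
  rw [locWeight, add_le_add_iff_left, div_le_iff₀ hr]
  exact h

theorem continuous_locWeight (r : ℝ) : Continuous (Function.uncurry (locWeight r : X → X → ℝ)) := by
  unfold locWeight
  simp only [Function.uncurry_def]
  fun_prop

theorem continuous_inv_locWeight_pow (hr : 0 < r) (m : ℕ) (x : X) :
    Continuous fun y => (locWeight r x y ^ m)⁻¹ := by
  have : Continuous fun y => locWeight r x y := (continuous_locWeight r).comp (Continuous.prodMk_right x)
  exact (this.pow m).inv₀ fun y => (pow_pos (locWeight_pos hr x y) m).ne'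

/-- With s = ρ/r one has (1 + s)^M ≤ exp(Ms), and Ms - κs² has maximum M²/(4κ). -/
theorem exp_neg_le_locWeight {κ : ℝ} (hκ : 0 < κ) (hr : 0 < r) (M : ℕ) (x y : X) :
    Real.exp (-κ * dist x y ^ 2 / r ^ 2) ≤
      Real.exp ((M : ℝ) ^ 2 / (4 * κ)) * (locWeight r x y ^ M)⁻¹ := by
  set s := dist x y / r with hs
  have h1 : locWeight r x y ^ M ≤ Real.exp (M * s) := by
    rw [Real.exp_nat_mul]
    refine pow_le_pow_left₀ (locWeight_pos hr x y).le ?_ M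
    rw [locWeight, add_comm]
    exact Real.add_one_le_exp s
  rw [le_mul_inv_iff₀ (pow_pos (locWeight_pos hr x y) M)]
  refine (mul_le_mul_of_nonneg_left h1 (Real.exp_pos _).le).trans ?_
  rw [← Real.exp_add, Real.exp_le_exp]
  have h2 : -κ * dist x y ^ 2 / r ^ 2 = -κ * s ^ 2 := by rw [hs, div_pow]; ring
  rw [h2, le_div_iff₀ (by positivity)]
  nlinarith [sq_nonneg (M - 2 * κ * s)]

end Weight

theorem sq_rpow_neg_div_two {r : ℝ} (hr : 0 < r) (α : ℝ) : (r ^ 2) ^ (-α / 2) = r ^ (-α) := by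
  rw [← Real.rpow_natCast, ← Real.rpow_mul hr.le]
  congr 1
  push_cast
  ring

theorem GaussianBounds.norm_le_locWeight {X : Type*} [MetricSpace X] {α κ₂ κ₃ κ₄ : ℝ}
    {φ : ℕ → X → ℂ} {ℓ : ℕ → ℝ} (h : GaussianBounds α κ₂ κ₃ κ₄ φ ℓ) (hκ₂ : 0 < κ₂)
    (hκ₃ : 0 < κ₃) {r : ℝ} (hr : 0 < r) (hr1 : r ≤ 1) (M : ℕ) (x y : X) :
    ‖heatKernel φ ℓ (r ^ 2) x y‖ ≤
      κ₂ * Real.exp ((M : ℝ) ^ 2 / (4 * κ₃)) * r ^ (-α) * (locWeight r x y ^ M)⁻¹ := by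
  refine (h.upper (r ^ 2) (by positivity) (by nlinarith) x y).trans ?_
  rw [sq_rpow_neg_div_two hr]
  have h1 := exp_neg_le_locWeight hκ₃ hr M x y
  calc _ ≤ κ₂ * r ^ (-α) * (Real.exp ((M : ℝ) ^ 2 / (4 * κ₃)) * (locWeight r x y ^ M)⁻¹) := by
        gcongr
    _ = _ := by ring

/-! ### Integrals of the weight, and lower volume bounds. -/

section Volume

variable {X : Type*} [MetricSpace X] [MeasurableSpace X] [BorelSpace X] {μ : Measure X}
  [IsProbabilityMeasure μ] {α κ₁ : ℝ}

/-- Integrals of negative powers of the weight `1 + ρ / r`. -/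
theorem exists_lintegral_locWeight_le (hκ₁ : 0 < κ₁)
    (hball : ∀ (x : X) (r : ℝ), 0 < r → μ.real (Metric.closedBall x r) ≤ κ₁ * r ^ α)
    {m : ℕ} (hm : α + 2 ≤ m) :
    ∃ V : ℝ, 0 < V ∧ ∀ r : ℝ, 0 < r → ∀ x : X,
      ∫⁻ y, ENNReal.ofReal ((locWeight r x y ^ m)⁻¹) ∂μ ≤ ENNReal.ofReal (V * r ^ α) := by
  have hsum : Summable fun j : ℕ => (((j : ℝ) + 1) ^ 2)⁻¹ := by
    have := (summable_nat_add_iff 1).2 (Real.summable_nat_pow_inv.2 one_lt_two)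
    simpa using this
  refine ⟨κ₁ * ∑' j : ℕ, (((j : ℝ) + 1) ^ 2)⁻¹,
    mul_pos hκ₁ (hsum.tsum_pos (fun j => by positivity) 0 (by positivity)), fun r hr x => ?_⟩
  -- Cut into shells jr ≤ ρ < (j+1)r. The j-th contributes at most a multiple of r^α (j+1)^(α-m),
  -- which is summable because m ≥ α + 2.
  have hpt : ∀ y, ENNReal.ofReal ((locWeight r x y ^ m)⁻¹) ≤ ∑' j : ℕ,
      ENNReal.ofReal ((((j : ℝ) + 1) ^ m)⁻¹) *
        (Metric.closedBall x ((j + 1) * r)).indicator 1 y := by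
    intro y
    set j := ⌊dist x y / r⌋₊ with hj
    refine le_trans ?_ (ENNReal.le_tsum j)
    have h1 : (j : ℝ) ≤ dist x y / r := Nat.floor_le (by positivity)
    have h2 : dist x y / r < j + 1 := Nat.lt_floor_add_one _
    rw [div_lt_iff₀ hr] at h2
    rw [Set.indicator_of_mem (by rw [Metric.mem_closedBall, dist_comm]; exact h2.le), Pi.one_apply,
      mul_one]
    refine ENNReal.ofReal_le_ofReal ?_
    have h3 : (j : ℝ) + 1 ≤ locWeight r x y := by rw [locWeight]; linarith
    gcongr
  calc ∫⁻ y, ENNReal.ofReal ((locWeight r x y ^ m)⁻¹) ∂μ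
      ≤ ∫⁻ y, ∑' j : ℕ, ENNReal.ofReal ((((j : ℝ) + 1) ^ m)⁻¹) *
        (Metric.closedBall x ((j + 1) * r)).indicator 1 y ∂μ := lintegral_mono hpt
    _ = ∑' j : ℕ, ENNReal.ofReal ((((j : ℝ) + 1) ^ m)⁻¹) *
        μ (Metric.closedBall x ((j + 1) * r)) := by
        rw [lintegral_tsum fun j => ((measurable_one.indicator
          Metric.isClosed_closedBall.measurableSet).const_mul _).aemeasurable]
        refine tsum_congr fun j => ?_
        rw [lintegral_const_mul _ (measurable_one.indicator
          Metric.isClosed_closedBall.measurableSet), lintegral_indicator_one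
          Metric.isClosed_closedBall.measurableSet]
    _ ≤ ∑' j : ℕ, ENNReal.ofReal (κ₁ * r ^ α * (((j : ℝ) + 1) ^ 2)⁻¹) := by
        refine ENNReal.tsum_le_tsum fun j => ?_
        have hj : (0 : ℝ) < j + 1 := by positivity
        rw [← ofReal_measureReal, ← ENNReal.ofReal_mul (by positivity)]
        refine ENNReal.ofReal_le_ofReal ?_
        calc (((j : ℝ) + 1) ^ m)⁻¹ * μ.real (Metric.closedBall x ((j + 1) * r))
            ≤ (((j : ℝ) + 1) ^ m)⁻¹ * (κ₁ * ((j + 1) * r) ^ α) := by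
              gcongr
              exact hball x _ (by positivity)
          _ = κ₁ * r ^ α * (((j : ℝ) + 1) ^ (α - m)) := by
              rw [Real.mul_rpow hj.le hr.le, Real.rpow_sub hj, Real.rpow_natCast]
              field_simp
          _ ≤ κ₁ * r ^ α * (((j : ℝ) + 1) ^ (-(2 : ℕ) : ℝ)) := by
              gcongr
              · linarith [(Nat.cast_nonneg j : (0 : ℝ) ≤ j)]
              · push_cast; linarith
          _ = _ := by rw [Real.rpow_neg hj.le, Real.rpow_natCast]
    _ = ENNReal.ofReal (κ₁ * (∑' j : ℕ, (((j : ℝ) + 1) ^ 2)⁻¹) * r ^ α) := by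
        rw [← ENNReal.ofReal_tsum_of_nonneg (fun j => by positivity) (hsum.mul_left _),
          tsum_mul_left]
        congr 1
        ring

variable [CompactSpace X]

theorem integrable_of_continuous {E : Type*} [NormedAddCommGroup E] {f : X → E}
    (hf : Continuous f) : Integrable f μ :=
  hf.integrable_of_hasCompactSupport (HasCompactSupport.of_compactSpace _)

theorem integral_le_of_lintegral_le {f : X → ℝ} (hf : Continuous f) (h0 : ∀ x, 0 ≤ f x) {B : ℝ}
    (hB : 0 ≤ B) (h : ∫⁻ x, ENNReal.ofReal (f x) ∂μ ≤ ENNReal.ofReal B) : ∫ x, f x ∂μ ≤ B := by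
  rw [← ofReal_integral_eq_lintegral_ofReal (integrable_of_continuous hf) (ae_of_all _ h0)] at h
  exact (ENNReal.ofReal_le_ofReal_iff hB).1 h

/-- Gaussian heat kernel bounds force balls to have measure at least `c r ^ α`. -/
theorem exists_le_measure_closedBall {κ₂ κ₃ κ₄ : ℝ} (hκ₁ : 0 < κ₁) (hκ₂ : 0 < κ₂)
    (hκ₃ : 0 < κ₃) (hκ₄ : 0 < κ₄)
    (hball : ∀ (x : X) (r : ℝ), 0 < r → μ.real (Metric.closedBall x r) ≤ κ₁ * r ^ α) :
    ∃ c : ℝ, 0 < c ∧ ∀ (φ : ℕ → X → ℂ) (ℓ : ℕ → ℝ), IsOrthonormalSystem μ φ ℓ →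
      GaussianBounds α κ₂ κ₃ κ₄ φ ℓ → ∀ (x : X) (r : ℝ), 0 < r → r ≤ 1 →
        c * r ^ α ≤ μ.real (Metric.closedBall x r) := by
  obtain ⟨m, hm⟩ := exists_nat_ge (α + 2)
  obtain ⟨V, hV, hvol⟩ := exists_lintegral_locWeight_le hκ₁ hball hm
  -- Decay of order m + 1: after squaring, m powers make the tail integrable and one further power
  -- supplies the factor 1/R.
  set E := κ₂ * Real.exp (((m + 1 : ℕ) : ℝ) ^ 2 / (4 * κ₃)) with hE
  have hE0 : 0 < E := by positivity
  set b := κ₄ * 2 ^ (-α / 2) with hb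
  have hb0 : 0 < b := by positivity
  -- At scale s = r/R the mass of |K|² outside B(x,r) is at most half the lower bound b s^(-α), so
  -- the ball carries the other half. The summand 2 gives s ≤ 1/2, hence 2s² ≤ 1.
  set R := 2 + 2 * (E ^ 2 * V) / b with hR
  have hR2 : 2 ≤ R := le_add_of_nonneg_right (by positivity)
  have hR0 : 0 < R := by linarith
  have hRV : E ^ 2 * V / R ≤ b / 2 := by
    rw [div_le_iff₀ hR0, hR]
    have : b / 2 * (2 + 2 * (E ^ 2 * V) / b) = b + E ^ 2 * V := by field_simp
    rw [this]
    linarith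
  refine ⟨b / 2 / κ₂ ^ 2 * R ^ (-α), by positivity, fun φ ℓ hs hg x r hr hr1 => ?_⟩
  set s := r / R with hsdef
  have hs0 : 0 < s := by positivity
  have hsr : s * R = r := by rw [hsdef]; field_simp
  have hs1 : s ≤ 1 / 2 := by
    rw [hsdef, div_le_div_iff₀ hR0 two_pos]
    linarith
  have hbnd : ∀ y, ‖heatKernel φ ℓ (s ^ 2) x y‖ ^ 2 ≤
      (κ₂ * s ^ (-α)) ^ 2 * (Metric.closedBall x r).indicator 1 y +
        (E * s ^ (-α)) ^ 2 / R * (locWeight s x y ^ m)⁻¹ := by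
    intro y
    have hw := locWeight_pos hs0 x y
    by_cases hy : y ∈ Metric.closedBall x r
    · rw [Set.indicator_of_mem hy, Pi.one_apply, mul_one]
      refine le_add_of_le_of_nonneg ?_ (by positivity)
      have := hg.norm_le hκ₂ hκ₃ (pow_pos hs0 2) (by nlinarith) x y
      rw [sq_rpow_neg_div_two hs0] at this
      gcongr
    · rw [Set.indicator_of_notMem hy, mul_zero, zero_add]
      have h1 := hg.norm_le_locWeight hκ₂ hκ₃ hs0 (by linarith) (m + 1) x y
      have hRw : R ≤ locWeight s x y := by
        rw [Metric.mem_closedBall, not_le, dist_comm, ← hsr] at hy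
        have : R ≤ dist x y / s := by rw [le_div_iff₀ hs0]; linarith
        rw [locWeight]; linarith
      have hw1 := one_le_locWeight hs0 x y
      calc ‖heatKernel φ ℓ (s ^ 2) x y‖ ^ 2
          ≤ (E * s ^ (-α) * (locWeight s x y ^ (m + 1))⁻¹) ^ 2 := by gcongr
        _ = (E * s ^ (-α)) ^ 2 * ((locWeight s x y ^ m)⁻¹ * (locWeight s x y ^ m)⁻¹ *
            (locWeight s x y)⁻¹ * (locWeight s x y)⁻¹) := by
            field_simp
            ring
        _ ≤ (E * s ^ (-α)) ^ 2 * ((locWeight s x y ^ m)⁻¹ * 1 * R⁻¹ * 1) := by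
            gcongr
            · exact inv_le_one_of_one_le₀ (one_le_pow₀ hw1)
            · exact inv_le_one_of_one_le₀ hw1
        _ = _ := by ring
  have hmeas : MeasurableSet (Metric.closedBall x r) := Metric.isClosed_closedBall.measurableSet
  have hi1 : Integrable ((Metric.closedBall x r).indicator (1 : X → ℝ)) μ :=
    (integrable_const (1 : ℝ)).indicator hmeas
  have hc2 := continuous_inv_locWeight_pow hs0 m x
  have hi2 : Integrable (fun y => (locWeight s x y ^ m)⁻¹) μ := integrable_of_continuous hc2
  have h2 : ∫ y, (locWeight s x y ^ m)⁻¹ ∂μ ≤ V * s ^ α :=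
    integral_le_of_lintegral_le hc2 (fun y => by have := locWeight_pos hs0 x y; positivity)
      (by positivity) (hvol s hs0 x)
  have h3 : ∫ y, ‖heatKernel φ ℓ (s ^ 2) x y‖ ^ 2 ∂μ ≤ (κ₂ * s ^ (-α)) ^ 2 *
      μ.real (Metric.closedBall x r) + (E * s ^ (-α)) ^ 2 / R * (V * s ^ α) := by
    calc _ ≤ ∫ y, ((κ₂ * s ^ (-α)) ^ 2 * (Metric.closedBall x r).indicator 1 y +
        (E * s ^ (-α)) ^ 2 / R * (locWeight s x y ^ m)⁻¹) ∂μ :=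
          integral_mono_of_nonneg (ae_of_all _ fun y => by positivity)
            ((hi1.const_mul _).add (hi2.const_mul _)) (ae_of_all _ hbnd)
      _ = (κ₂ * s ^ (-α)) ^ 2 * μ.real (Metric.closedBall x r) +
          (E * s ^ (-α)) ^ 2 / R * ∫ y, (locWeight s x y ^ m)⁻¹ ∂μ := by
          rw [integral_add (hi1.const_mul _) (hi2.const_mul _), integral_const_mul,
            integral_const_mul, integral_indicator_one hmeas]
      _ ≤ _ := by gcongr
  rw [hg.integral_norm_sq hs hκ₂ hκ₃ hκ₄ (pow_pos hs0 2) (by nlinarith)] at h3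
  have h4 := hg.lower (2 * s ^ 2) (by positivity) (by nlinarith) x
  rw [Real.mul_rpow two_pos.le (by positivity), sq_rpow_neg_div_two hs0, ← mul_assoc, ← hb] at h4
  have hp0 : 0 < s ^ α := Real.rpow_pos_of_pos hs0 α
  have hneg : s ^ (-α) = (s ^ α)⁻¹ := Real.rpow_neg hs0.le α
  have hsα : s ^ α = r ^ α * R ^ (-α) := by
    rw [hsdef, Real.div_rpow hr.le hR0.le, Real.rpow_neg hR0.le, div_eq_mul_inv]
  have h5 : b * (s ^ α)⁻¹ ≤ κ₂ ^ 2 * ((s ^ α)⁻¹) ^ 2 * μ.real (Metric.closedBall x r) +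
      b / 2 * (s ^ α)⁻¹ := by
    rw [hneg] at h3 h4
    have h6 : (E * (s ^ α)⁻¹) ^ 2 / R * (V * s ^ α) = E ^ 2 * V / R * (s ^ α)⁻¹ := by
      field_simp
    have h7 : E ^ 2 * V / R * (s ^ α)⁻¹ ≤ b / 2 * (s ^ α)⁻¹ := by gcongr
    rw [h6, mul_pow] at h3
    linarith
  have h8 : b / 2 * (s ^ α)⁻¹ ≤ κ₂ ^ 2 * ((s ^ α)⁻¹) ^ 2 * μ.real (Metric.closedBall x r) := by
    linarith
  have h9 : b / 2 * s ^ α ≤ κ₂ ^ 2 * μ.real (Metric.closedBall x r) := by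
    have h10 := mul_le_mul_of_nonneg_right h8 (sq_nonneg (s ^ α))
    have e1 : b / 2 * (s ^ α)⁻¹ * (s ^ α) ^ 2 = b / 2 * s ^ α := by field_simp
    have e2 : κ₂ ^ 2 * ((s ^ α)⁻¹) ^ 2 * μ.real (Metric.closedBall x r) * (s ^ α) ^ 2 =
      κ₂ ^ 2 * μ.real (Metric.closedBall x r) := by field_simp
    rwa [e1, e2] at h10
  calc b / 2 / κ₂ ^ 2 * R ^ (-α) * r ^ α = b / 2 * s ^ α / κ₂ ^ 2 := by rw [hsα]; ring
    _ ≤ _ := by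
      rw [div_le_iff₀ (by positivity)]
      linarith

end Volume

/-- Since b ≥ 1, a is at most (1 + d) b. The difference therefore costs only b^k, one power less,
times a polynomial in d that kernel decay can pay for. -/
theorem abs_pow_succ_sub_pow_succ_le {a b d : ℝ} (ha : 1 ≤ a) (hb : 1 ≤ b) (hd : 0 ≤ d)
    (hab : |a - b| ≤ d) (k : ℕ) :
    |a ^ (k + 1) - b ^ (k + 1)| ≤ (k + 1) * (1 + d) ^ (k + 1) * b ^ k := by
  have h1 := abs_pow_sub_pow_le a b (k + 1)
  rw [Nat.add_sub_cancel, abs_of_pos (by linarith : 0 < a), abs_of_pos (by linarith : 0 < b)] at h1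
  have h2 : max a b ≤ (1 + d) * b := by
    have := (abs_le.1 hab).2
    refine max_le ?_ ?_ <;> nlinarith
  have h3 : 0 ≤ max a b := by linarith [le_max_left a b]
  calc _ ≤ |a - b| * ((k + 1 : ℕ) : ℝ) * max a b ^ k := h1
    _ ≤ (1 + d) * ((k + 1 : ℕ) : ℝ) * ((1 + d) * b) ^ k := by
      gcongr
      linarith
    _ = _ := by rw [mul_pow]; push_cast; ring

/-! ### Commutators of the weights with the heat operator. -/

section Localization

variable {X : Type*} [MetricSpace X] [CompactSpace X] [MeasurableSpace X] [BorelSpace X]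
  {μ : Measure X} [IsProbabilityMeasure μ] {α κ₂ κ₃ κ₄ : ℝ}

/-- The heat operator on `L²(μ)`, together with multiplication by powers of the weight
`1 + ρ(x₀, ·) / r`, which almost commute with the heat operator at time `r²`. -/
theorem exists_heatOperator (hκ₂ : 0 < κ₂) (hκ₃ : 0 < κ₃) (hκ₄ : 0 < κ₄) {m : ℕ} {V : ℝ}
    (hV : 0 < V) (hvol : ∀ r : ℝ, 0 < r → ∀ x : X,
      ∫⁻ y, ENNReal.ofReal ((locWeight r x y ^ m)⁻¹) ∂μ ≤ ENNReal.ofReal (V * r ^ α)) :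
    ∃ C : ℝ, 0 ≤ C ∧ ∀ (φ : ℕ → X → ℂ) (ℓ : ℕ → ℝ), IsOrthonormalSystem μ φ ℓ →
      GaussianBounds α κ₂ κ₃ κ₄ φ ℓ → ∀ (r : ℝ), 0 < r → r ≤ 1 → ∀ x₀ : X,
      ∃ (T : Lp ℂ 2 μ →L[ℂ] Lp ℂ 2 μ) (W : ℕ → Lp ℂ 2 μ →L[ℂ] Lp ℂ 2 μ), IsSelfAdjoint T ∧
        (∀ f, T f =ᵐ[μ] fun y => ∫ z, heatKernel φ ℓ (r ^ 2) y z * f z ∂μ) ∧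
        (∀ k f, W k f =ᵐ[μ] fun y => ((locWeight r x₀ y ^ k : ℝ) : ℂ) * f y) ∧ W 0 = 1 ∧
        (∀ k f, ‖W k f‖ ≤ ‖W (k + 1) f‖) ∧
        ∀ k < m, ∀ f, ‖W (k + 1) (T f) - T (W (k + 1) f)‖ ≤ C * ‖W k f‖ := by
  -- Decay of order 2m: m powers absorb the growth of the weight difference, and the other m make
  -- the commutator kernel integrable.
  set E := κ₂ * Real.exp (((2 * m : ℕ) : ℝ) ^ 2 / (4 * κ₃)) with hE
  have hE0 : 0 < E := by positivity
  refine ⟨m * E * V, by positivity, fun φ ℓ hs hg r hr hr1 x₀ => ?_⟩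
  have hK := hg.measurable hs.continuous hκ₄ (pow_pos hr 2) (by nlinarith : r ^ 2 ≤ 1)
  have hKb := fun x y => hg.norm_le hκ₂ hκ₃ (pow_pos hr 2) (by nlinarith : r ^ 2 ≤ 1) x y
  obtain ⟨T, hT⟩ := exists_integralOperator (μ := μ) hK hKb
  have hw1 := fun y => one_le_locWeight hr x₀ y
  have hwc : ∀ k : ℕ, Continuous fun y => locWeight r x₀ y ^ k := fun k =>
    ((continuous_locWeight r).comp (Continuous.prodMk_right x₀)).pow k
  have hW : ∀ k : ℕ, ∃ W : Lp ℂ 2 μ →L[ℂ] Lp ℂ 2 μ,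
      ∀ f, W f =ᵐ[μ] fun y => ((locWeight r x₀ y ^ k : ℝ) : ℂ) * f y := fun k => by
    obtain ⟨B, hB⟩ := isCompact_univ.exists_bound_of_continuousOn (hwc k).continuousOn
    exact exists_mulOperator (hwc k).measurable fun y => hB y trivial
  choose W hW using hW
  refine ⟨T, W, isSelfAdjoint_of_hermitian_kernel hK hKb
    (conj_heatKernel φ ℓ _) hT, hT, hW, ?_, fun k f => ?_, fun k hk f => ?_⟩
  · ext1 f
    refine Lp.ext ?_
    filter_upwards [hW 0 f] with y hy
    simp [hy]
  · refine Lp.norm_le_norm_of_ae_le ?_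
    filter_upwards [hW k f, hW (k + 1) f] with y h1 h2
    rw [h1, h2, norm_mul, norm_mul, Complex.norm_real, Complex.norm_real, Real.norm_eq_abs,
      Real.norm_eq_abs, abs_of_pos (pow_pos (locWeight_pos hr x₀ y) _),
      abs_of_pos (pow_pos (locWeight_pos hr x₀ y) _)]
    exact mul_le_mul_of_nonneg_right (pow_le_pow_right₀ (hw1 y) k.le_succ) (norm_nonneg _)
  · have hwy : ∀ y z, |locWeight r x₀ y - locWeight r x₀ z| ≤ dist y z / r := fun y z => by
      rw [locWeight, locWeight, add_sub_add_left_eq_sub, ← sub_div, abs_div, abs_of_pos hr,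
        dist_comm x₀ y, dist_comm x₀ z]
      exact div_le_div_of_nonneg_right (abs_dist_sub_le y z x₀) hr.le
    -- The commutator has kernel (w^(k+1)(y) - w^(k+1)(z)) K(y,z). Dividing by w^k(z) leaves
    -- something dominated by J, so Schur's test is applied to J acting on w^k f; the factors r^(-α)
    -- and r^α cancel in its row integrals.
    set J : X → X → ℝ := fun y z => m * E * r ^ (-α) * (locWeight r y z ^ m)⁻¹ with hJ
    have hJ0 : ∀ y z, 0 ≤ J y z := fun y z => by
      have := locWeight_pos hr y z
      positivity
    have hJm : Measurable (Function.uncurry fun y z => ENNReal.ofReal (J y z)) :=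
      ENNReal.measurable_ofReal.comp
        ((((continuous_locWeight r).measurable.pow_const m).inv).const_mul _)
    have hpt : ∀ y z, ‖((locWeight r x₀ y ^ (k + 1) - locWeight r x₀ z ^ (k + 1) : ℝ) : ℂ) *
        heatKernel φ ℓ (r ^ 2) y z‖ ≤ J y z * locWeight r x₀ z ^ k := by
      intro y z
      have hp := locWeight_pos hr y z
      have hp0 := locWeight_pos hr x₀ z
      have h1 := abs_pow_succ_sub_pow_succ_le (hw1 y) (hw1 z) (by positivity) (hwy y z) k
      have h2 := hg.norm_le_locWeight hκ₂ hκ₃ hr hr1 (2 * m) y z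
      rw [norm_mul, Complex.norm_real, Real.norm_eq_abs]
      have hk' : (k : ℝ) + 1 ≤ m := by exact_mod_cast hk
      have h3 : (1 + dist y z / r) ^ (k + 1) ≤ locWeight r y z ^ m :=
        pow_le_pow_right₀ (one_le_locWeight hr y z) hk
      calc _ ≤ ((k + 1) * (1 + dist y z / r) ^ (k + 1) * locWeight r x₀ z ^ k) *
            (E * r ^ (-α) * (locWeight r y z ^ (2 * m))⁻¹) := by gcongr
        _ ≤ (m * locWeight r y z ^ m * locWeight r x₀ z ^ k) *
            (E * r ^ (-α) * (locWeight r y z ^ (2 * m))⁻¹) := by gcongr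
        _ = _ := by
          rw [hJ, two_mul, pow_add]
          field_simp
    have hJ1 : ∀ y, ∫⁻ z, ENNReal.ofReal (J y z) ∂μ ≤ ENNReal.ofReal (m * E * V) := by
      intro y
      have hc : 0 ≤ m * E * r ^ (-α) := by positivity
      simp_rw [hJ, ENNReal.ofReal_mul hc]
      rw [lintegral_const_mul' _ _ ENNReal.ofReal_ne_top]
      refine (mul_le_mul_right (hvol r hr y) _).trans_eq ?_
      rw [← ENNReal.ofReal_mul hc, Real.rpow_neg hr.le]
      congr 1
      have : r ^ α ≠ 0 := (Real.rpow_pos_of_pos hr α).ne'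
      field_simp
    refine norm_le_of_schur hJm (by positivity) hJ1 (fun z => ?_) ?_
    · refine le_of_eq_of_le (lintegral_congr fun y => ?_) (hJ1 z)
      simp only [hJ, locWeight_comm r y z]
    · filter_upwards [hW (k + 1) (T f), hT f, hT (W (k + 1) f),
        Lp.coeFn_sub (W (k + 1) (T f)) (T (W (k + 1) f))] with y h1 h2 h3 h4
      have hKy : Measurable (heatKernel φ ℓ (r ^ 2) y) := hK.comp measurable_prodMk_left
      have h5 : ∫ z, heatKernel φ ℓ (r ^ 2) y z * (W (k + 1) f) z ∂μ =
          ∫ z, heatKernel φ ℓ (r ^ 2) y z * (((locWeight r x₀ z ^ (k + 1) : ℝ) : ℂ) * f z) ∂μ := by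
        refine integral_congr_ae ?_
        filter_upwards [hW (k + 1) f] with z hz
        rw [hz]
      have h6 : Integrable (fun z => heatKernel φ ℓ (r ^ 2) y z *
          (((locWeight r x₀ z ^ (k + 1) : ℝ) : ℂ) * f z)) μ := by
        refine (integrable_bounded_mul hKy (hKb y) (W (k + 1) f)).congr ?_
        filter_upwards [hW (k + 1) f] with z hz
        rw [hz]
      rw [h4, Pi.sub_apply, h1, h2, h3, h5, ← integral_const_mul,
        ← integral_sub ((integrable_bounded_mul hKy (hKb y) f).const_mul _) h6]
      refine (enorm_integral_le_lintegral_enorm _).trans (lintegral_mono_ae ?_)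
      filter_upwards [hW k f] with z hz
      have hp0 := locWeight_pos hr x₀ z
      rw [hz, ← ofReal_norm, ← ofReal_norm, ← ENNReal.ofReal_mul (hJ0 y z)]
      refine ENNReal.ofReal_le_ofReal ?_
      rw [norm_mul, Complex.norm_real, Real.norm_eq_abs, abs_of_pos (pow_pos hp0 k),
        ← mul_assoc (J y z)]
      refine le_trans (le_of_eq ?_) (mul_le_mul_of_nonneg_right (hpt y z) (norm_nonneg _))
      rw [← norm_mul]
      congr 1
      push_cast
      ring

end Localization

/-! ### Reproducing diffusion polynomials and bounding their oscillation. -/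

section Reproducing


theorem enorm_inner_le_lintegral {X : Type*} [MeasurableSpace X] {μ : Measure X}
    (f g : Lp ℂ 2 μ) :
    ‖inner ℂ f g‖ₑ ≤ ∫⁻ x, ‖f x‖ₑ * ‖g x‖ₑ ∂μ := by
  rw [L2.inner_def]
  refine (enorm_integral_le_lintegral_enorm _).trans (lintegral_mono fun x => ?_)
  rw [RCLike.inner_apply, enorm_mul, mul_comm, ← ofReal_norm, RCLike.norm_conj, ofReal_norm]

theorem continuous_of_mem_diffusionPolynomials {X : Type*} [TopologicalSpace X]
    {φ : ℕ → X → ℂ} (hφ : ∀ k, Continuous (φ k)) {ℓ : ℕ → ℝ} {L : ℝ} {P : X → ℂ} (hP : P ∈ diffusionPolynomials φ ℓ L) : Continuous P := by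
  induction hP using Submodule.span_induction with
  | mem f hf => obtain ⟨j, -, rfl⟩ := hf; exact hφ j
  | zero => exact continuous_const
  | add f g _ _ hf hg => exact hf.add hg
  | smul c f _ hf => exact continuous_const.mul hf

variable {X : Type*} [MetricSpace X] [CompactSpace X] [MeasurableSpace X] [BorelSpace X]
  {μ : Measure X} [IsProbabilityMeasure μ] {α κ₂ κ₃ κ₄ : ℝ}

/-- The oscillation of a diffusion polynomial is controlled by that of the heat kernel at the
corresponding scale. -/
theorem exists_norm_sub_le_of_heatKernel_sub_le (hκ₂ : 0 < κ₂) (hκ₃ : 0 < κ₃) (hκ₄ : 0 < κ₄)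
    {m : ℕ} {V : ℝ} (hV : 0 < V) (hvol : ∀ r : ℝ, 0 < r → ∀ x : X,
      ∫⁻ y, ENNReal.ofReal ((locWeight r x y ^ m)⁻¹) ∂μ ≤ ENNReal.ofReal (V * r ^ α)) :
    ∃ C : ℝ, 0 ≤ C ∧ ∀ (φ : ℕ → X → ℂ) (ℓ : ℕ → ℝ), IsOrthonormalSystem μ φ ℓ →
      GaussianBounds α κ₂ κ₃ κ₄ φ ℓ → ∀ (r : ℝ), 0 < r → r ≤ 1 → ∀ (x₀ y z : X) (D : ℝ), 0 ≤ D →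
      (∀ x, ‖heatKernel φ ℓ (r ^ 2) x y - heatKernel φ ℓ (r ^ 2) x z‖ ≤
        D * (locWeight r x₀ x ^ (2 * m))⁻¹) →
      ∀ P ∈ diffusionPolynomials φ ℓ r⁻¹,
        ‖P y - P z‖ ≤ C * D * ∫ u, ‖P u‖ * (locWeight r x₀ u ^ m)⁻¹ ∂μ := by
  obtain ⟨C₁, hC₁, hop⟩ := exists_heatOperator (μ := μ) hκ₂ hκ₃ hκ₄ hV hvol
  have he1 : Real.exp (-1) ≤ 1 := Real.exp_le_one_iff.2 (by norm_num)
  obtain ⟨g, hg⟩ := exists_schwartz_eq_inv_sq (Real.exp_pos (-1)) he1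
  obtain ⟨B, hB, hcalc⟩ := exists_schwartz_functional_calculus g m hC₁
  set E := κ₂ * Real.exp (((2 * m : ℕ) : ℝ) ^ 2 / (4 * κ₃)) with hE
  have hE0 : 0 < E := by positivity
  refine ⟨B * E * V, by positivity, fun φ ℓ hs hgb r hr hr1 x₀ y z D hD hyz P hP => ?_⟩
  have hr2 : r ^ 2 ≤ 1 := by nlinarith
  obtain ⟨T, W, hTsa, hT, hW, hW0, hWm, hWc⟩ := hop φ ℓ hs hgb r hr hr1 x₀
  have hK := hgb.measurable hs.continuous hκ₄ (pow_pos hr 2) hr2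
  have hKb := fun x y => hgb.norm_le hκ₂ hκ₃ (pow_pos hr 2) hr2 x y
  have hwp := fun x y : X => locWeight_pos hr x y
  have hrα : 0 < r ^ α := Real.rpow_pos_of_pos hr α
  have hsqrt : Real.sqrt (V * r ^ α) ^ 2 = V * r ^ α := Real.sq_sqrt (by positivity)
  -- the `L²` norm of `(1 + ρ / r) ^ (-m)`
  have hvol2 : ∀ x : X, ∫⁻ y, ENNReal.ofReal ((locWeight r x y ^ m)⁻¹) ^ 2 ∂μ ≤
      ENNReal.ofReal (V * r ^ α) := fun x => by
    refine (lintegral_mono fun y => ?_).trans (hvol r hr x)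
    refine pow_le_of_le_one (zero_le) ?_ two_ne_zero
    refine ENNReal.ofReal_le_one.2 (inv_le_one_of_one_le₀ (one_le_pow₀ (one_le_locWeight hr x y)))
  set h₀ : X → ℂ := fun x => heatKernel φ ℓ (r ^ 2) x y - heatKernel φ ℓ (r ^ 2) x z with hh₀
  have hh₀m : Measurable h₀ :=
    (hK.comp measurable_prodMk_right).sub (hK.comp measurable_prodMk_right)
  have hh₀L : MemLp h₀ 2 μ := MemLp.of_bound hh₀m.aestronglyMeasurable D
    (ae_of_all _ fun x => (hyz x).trans (mul_le_of_le_one_right hD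
      (inv_le_one_of_one_le₀ (one_le_pow₀ (one_le_locWeight hr x₀ x)))))
  -- The vector v obtained from h is g(T)h. It inherits the weighted L² decay of h, including the
  -- small factor D.
  set h : Lp ℂ 2 μ := hh₀L.toLp h₀ with hh
  obtain ⟨v, hv, hve⟩ := hcalc T hTsa W hW0 hWm hWc h
  have hWh : ‖W m h‖ ≤ D * Real.sqrt (V * r ^ α) := by
    refine norm_le_mul_of_enorm_le (F := fun x => D * (locWeight r x₀ x ^ m)⁻¹) (by positivity)
      ?_ ?_
    · filter_upwards [hW m h, hh₀L.coeFn_toLp] with x h1 h2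
      have hp := hwp x₀ x
      rw [h1, hh, h2, norm_mul, Complex.norm_real, Real.norm_eq_abs, abs_of_pos (pow_pos hp m)]
      calc _ ≤ locWeight r x₀ x ^ m * (D * (locWeight r x₀ x ^ (2 * m))⁻¹) := by
            gcongr
            exact hyz x
        _ = _ := by
            rw [two_mul, pow_add]
            field_simp
    · simp_rw [ENNReal.ofReal_mul hD, mul_pow]
      rw [lintegral_const_mul' _ _ (ENNReal.pow_ne_top ENNReal.ofReal_ne_top), hsqrt,
        ENNReal.ofReal_mul (by positivity), ENNReal.ofReal_pow hD]
      gcongr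
      exact hvol2 x₀
  -- `P y - P z` is the inner product of `v` with the heat operator applied to `P`
  have hrep : ∃ F : Lp ℂ 2 μ, F =ᵐ[μ] P ∧ P y - P z = inner ℂ v (T F) := by
    induction hP using Submodule.span_induction with
    | mem f hf =>
      obtain ⟨j, hj, rfl⟩ := hf
      have hL : MemLp (φ j) 2 μ := by
        obtain ⟨b, hb⟩ := isCompact_univ.exists_bound_of_continuousOn (hs.continuous j).continuousOn
        exact MemLp.of_bound (hs.continuous j).aestronglyMeasurable b
          (ae_of_all _ fun x => hb x trivial)
      refine ⟨hL.toLp _, hL.coeFn_toLp, ?_⟩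
      -- Since 0 ≤ ℓ_j r ≤ 1, this eigenvalue lies in [1/e, 1], where g is exactly the inverse
      -- square.
      set c := Real.exp (-(ℓ j) ^ 2 * r ^ 2) with hc
      have hc0 : (c : ℂ) ≠ 0 := by exact_mod_cast (Real.exp_pos _).ne'
      have hcI : c ∈ Set.Icc (Real.exp (-1)) 1 := by
        have h1 : 1 ≤ ℓ j := hs.ell_zero ▸ hs.mono (Nat.zero_le j)
        have h2 : ℓ j * r ≤ 1 := by
          calc ℓ j * r ≤ r⁻¹ * r := by gcongr
            _ = 1 := inv_mul_cancel₀ hr.ne'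
        have h3 : 0 ≤ ℓ j * r := by positivity
        constructor
        · rw [hc, Real.exp_le_exp]; nlinarith
        · rw [hc, Real.exp_le_one_iff]; nlinarith [sq_nonneg (ℓ j * r)]
      have hTe : T (hL.toLp _) = (c : ℂ) • hL.toLp _ := by
        refine Lp.ext ?_
        filter_upwards [hT (hL.toLp _), Lp.coeFn_smul (c : ℂ) (hL.toLp _), hL.coeFn_toLp]
          with x h1 h2 h3
        rw [h1, h2, Pi.smul_apply, h3, smul_eq_mul,
          ← hgb.integral_heatKernel_mul_phi hs hκ₂ hκ₃ hκ₄ (pow_pos hr 2) hr2]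
        refine integral_congr_ae ?_
        filter_upwards [hL.coeFn_toLp] with u hu
        rw [hu]
      have hinner : inner ℂ h (hL.toLp _) = (c : ℂ) * (φ j y - φ j z) := by
        rw [L2.inner_def, mul_sub,
          ← hgb.integral_heatKernel_mul_phi hs hκ₂ hκ₃ hκ₄ (pow_pos hr 2) hr2 j y,
          ← hgb.integral_heatKernel_mul_phi hs hκ₂ hκ₃ hκ₄ (pow_pos hr 2) hr2 j z, ← integral_sub]
        · refine integral_congr_ae ?_
          filter_upwards [hL.coeFn_toLp, hh₀L.coeFn_toLp] with u h1 h2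
          rw [RCLike.inner_apply, h1, h2, hh₀, map_sub, conj_heatKernel, conj_heatKernel]
          ring
        · exact (hL.integrable one_le_two).bdd_mul (hK.comp measurable_prodMk_left
            : Measurable (heatKernel φ ℓ (r ^ 2) y)).aestronglyMeasurable (ae_of_all _ (hKb y))
        · exact (hL.integrable one_le_two).bdd_mul (hK.comp measurable_prodMk_left
            : Measurable (heatKernel φ ℓ (r ^ 2) z)).aestronglyMeasurable (ae_of_all _ (hKb z))
      -- One factor c comes from T on the right, one from pairing h with φ_j, and g(c) = c⁻² cancels
      -- both.
      rw [hTe, inner_smul_right, ← inner_conj_symm, hve _ c hTe, map_mul, inner_conj_symm, hinner,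
        hg c hcI, map_inv₀, map_pow, Complex.conj_ofReal]
      field_simp
    | zero =>
      exact ⟨0, Lp.coeFn_zero _ _ _, by simp⟩
    | add p q _ _ hp hq =>
      obtain ⟨F, hF, hF'⟩ := hp
      obtain ⟨G, hG, hG'⟩ := hq
      refine ⟨F + G, (Lp.coeFn_add F G).trans (hF.add hG), ?_⟩
      rw [map_add, inner_add_right, ← hF', ← hG', Pi.add_apply, Pi.add_apply]
      ring
    | smul c p _ hp =>
      obtain ⟨F, hF, hF'⟩ := hp
      refine ⟨c • F, (Lp.coeFn_smul c F).trans (hF.const_smul c), ?_⟩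
      rw [map_smul, inner_smul_right, ← hF', Pi.smul_apply, Pi.smul_apply, smul_eq_mul,
        smul_eq_mul]
      ring
  obtain ⟨F, hF, hrep⟩ := hrep
  have hPc := continuous_of_mem_diffusionPolynomials hs.continuous hP
  have hvm : Measurable fun x => ‖v x‖ₑ := (Lp.stronglyMeasurable v).measurable.enorm
  set Q := ‖W m v‖ * (E * r ^ (-α) * Real.sqrt (V * r ^ α)) with hQ
  have hQ0 : 0 ≤ Q := by positivity
  -- Submultiplicativity of the weight moves decay from x to u. Of the 2m powers of decay of K, m
  -- are traded for the decay in u and for the weight on v; the rest stay for Cauchy–Schwarz.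
  have hinner : ∀ u, ∫⁻ x, ‖v x‖ₑ * ‖heatKernel φ ℓ (r ^ 2) x u‖ₑ ∂μ ≤
      ENNReal.ofReal (Q * (locWeight r x₀ u ^ m)⁻¹) := by
    intro u
    set q : X → ℝ≥0∞ := fun x => ENNReal.ofReal (E * r ^ (-α) * (locWeight r u x ^ m)⁻¹) with hq
    have hqm : Measurable q := ENNReal.measurable_ofReal.comp
      ((continuous_inv_locWeight_pow hr m u).measurable.const_mul _)
    have hWvm : Measurable fun x => ‖W m v x‖ₑ :=
      (Lp.stronglyMeasurable (W m v)).measurable.enorm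
    have h1 : ∀ᵐ x ∂μ, ‖v x‖ₑ * ‖heatKernel φ ℓ (r ^ 2) x u‖ₑ ≤
        ENNReal.ofReal ((locWeight r x₀ u ^ m)⁻¹) * (‖W m v x‖ₑ * q x) := by
      filter_upwards [hW m v] with x hx
      have hp := hwp x₀ x
      have hp' := hwp x u
      have hp'' := hwp x₀ u
      rw [hx, hq, ← ofReal_norm, ← ofReal_norm, ← ofReal_norm,
        ← ENNReal.ofReal_mul (norm_nonneg _), ← ENNReal.ofReal_mul (norm_nonneg _),
        ← ENNReal.ofReal_mul (by positivity), norm_mul, Complex.norm_real, Real.norm_eq_abs,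
        abs_of_pos (pow_pos hp m), locWeight_comm r u x]
      refine ENNReal.ofReal_le_ofReal ?_
      have h2 := hgb.norm_le_locWeight hκ₂ hκ₃ hr hr1 (2 * m) x u
      have h3 : locWeight r x₀ u ^ m ≤ locWeight r x₀ x ^ m * locWeight r x u ^ m := by
        rw [← mul_pow]
        exact pow_le_pow_left₀ hp''.le (locWeight_le_mul hr x₀ x u) m
      have h4 : (locWeight r x u ^ m)⁻¹ ≤ (locWeight r x₀ u ^ m)⁻¹ * locWeight r x₀ x ^ m := by
        rw [inv_mul_eq_div, ← one_div, div_le_div_iff₀ (by positivity) (by positivity), one_mul]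
        exact h3
      calc ‖v x‖ * ‖heatKernel φ ℓ (r ^ 2) x u‖
          ≤ ‖v x‖ * (E * r ^ (-α) * (locWeight r x u ^ (2 * m))⁻¹) := by gcongr
        _ = ‖v x‖ * (E * r ^ (-α)) * (locWeight r x u ^ m)⁻¹ * (locWeight r x u ^ m)⁻¹ := by
            rw [two_mul, pow_add, mul_inv]; ring
        _ ≤ ‖v x‖ * (E * r ^ (-α)) * ((locWeight r x₀ u ^ m)⁻¹ * locWeight r x₀ x ^ m) *
            (locWeight r x u ^ m)⁻¹ := by gcongr
        _ = _ := by ring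
    have h5 : ∫⁻ x, ‖W m v x‖ₑ * q x ∂μ ≤ ENNReal.ofReal Q := by
      refine (ENNReal.pow_le_pow_left_iff two_ne_zero).1
        ((sq_lintegral_mul_le hWvm.aemeasurable hqm.aemeasurable).trans ?_)
      rw [← enorm_sq_eq_lintegral, hQ, ENNReal.ofReal_mul (norm_nonneg _), mul_pow, ofReal_norm,
        ← ENNReal.ofReal_pow (by positivity), mul_pow, hsqrt, ENNReal.ofReal_mul (by positivity),
        ENNReal.ofReal_pow (by positivity)]
      gcongr
      simp_rw [hq, ENNReal.ofReal_mul (by positivity : 0 ≤ E * r ^ (-α)), mul_pow]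
      rw [lintegral_const_mul' _ _ (ENNReal.pow_ne_top ENNReal.ofReal_ne_top)]
      gcongr
      exact hvol2 u
    refine (lintegral_mono_ae h1).trans ?_
    rw [lintegral_const_mul' _ _ ENNReal.ofReal_ne_top, mul_comm, ENNReal.ofReal_mul hQ0]
    gcongr
  have hfin : ENNReal.ofReal ‖P y - P z‖ ≤
      ENNReal.ofReal (Q * ∫ u, ‖P u‖ * (locWeight r x₀ u ^ m)⁻¹ ∂μ) := by
    have hc : Continuous fun u => ‖P u‖ * (locWeight r x₀ u ^ m)⁻¹ :=
      hPc.norm.mul (continuous_inv_locWeight_pow hr m x₀)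
    have hTF : ∀ᵐ x ∂μ, ‖T F x‖ₑ ≤ ∫⁻ u, ‖heatKernel φ ℓ (r ^ 2) x u‖ₑ * ‖P u‖ₑ ∂μ := by
      filter_upwards [hT F] with x hx
      rw [hx]
      refine (enorm_integral_le_lintegral_enorm _).trans (lintegral_mono_ae ?_)
      filter_upwards [hF] with u hu
      rw [enorm_mul, hu]
    have hKe : Measurable fun q : X × X => ‖heatKernel φ ℓ (r ^ 2) q.1 q.2‖ₑ := hK.enorm
    rw [ofReal_norm, hrep]
    calc ‖inner ℂ v (T F)‖ₑ ≤ ∫⁻ x, ‖v x‖ₑ * ‖T F x‖ₑ ∂μ := enorm_inner_le_lintegral _ _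
      _ ≤ ∫⁻ x, ∫⁻ u, ‖P u‖ₑ * (‖v x‖ₑ * ‖heatKernel φ ℓ (r ^ 2) x u‖ₑ) ∂μ ∂μ := by
          refine lintegral_mono_ae ?_
          filter_upwards [hTF] with x hx
          refine (mul_le_mul_right hx _).trans_eq ?_
          rw [← lintegral_const_mul' _ _ enorm_ne_top]
          refine lintegral_congr fun u => ?_
          ring
      _ = ∫⁻ u, ∫⁻ x, ‖P u‖ₑ * (‖v x‖ₑ * ‖heatKernel φ ℓ (r ^ 2) x u‖ₑ) ∂μ ∂μ :=
          lintegral_lintegral_swap ((hPc.measurable.enorm.comp measurable_snd).mul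
            ((hvm.comp measurable_fst).mul hKe)).aemeasurable
      _ ≤ ∫⁻ u, ENNReal.ofReal (Q * (‖P u‖ * (locWeight r x₀ u ^ m)⁻¹)) ∂μ := by
          refine lintegral_mono fun u => ?_
          rw [lintegral_const_mul' _ _ enorm_ne_top]
          refine (mul_le_mul_right (hinner u) _).trans_eq ?_
          rw [← ofReal_norm, ← ENNReal.ofReal_mul (norm_nonneg _)]
          congr 1
          ring
      _ = _ := by
          have hc' : Continuous fun u => Q * (‖P u‖ * (locWeight r x₀ u ^ m)⁻¹) :=
            continuous_const.mul hc
          rw [← ofReal_integral_eq_lintegral_ofReal (integrable_of_continuous hc')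
            (ae_of_all _ fun u => ?_), integral_const_mul]
          have := hwp x₀ u
          simp only [Pi.zero_apply]
          positivity
  have hI0 : 0 ≤ ∫ u, ‖P u‖ * (locWeight r x₀ u ^ m)⁻¹ ∂μ := integral_nonneg fun u => by
    have := hwp x₀ u
    simp only [Pi.zero_apply]
    positivity
  refine ((ENNReal.ofReal_le_ofReal_iff (by positivity)).1 hfin).trans
    (mul_le_mul_of_nonneg_right ?_ hI0)
  -- Each of the two L² norms contributes a square root of V r^α, and together they cancel the
  -- kernel's r^(-α); no power of r remains besides the one inside D.
  calc Q ≤ (B * (D * Real.sqrt (V * r ^ α))) * (E * r ^ (-α) * Real.sqrt (V * r ^ α)) := by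
        rw [hQ]
        gcongr
        exact hv.trans (mul_le_mul_of_nonneg_left hWh hB)
    _ = B * D * E * r ^ (-α) * Real.sqrt (V * r ^ α) ^ 2 := by ring
    _ = B * E * V * D := by
        rw [hsqrt, Real.rpow_neg hr.le]
        field_simp

end Reproducing

/-! ### From the gradient bound to the oscillation of polynomials. -/

section Manifold

variable {n : ℕ} {X : Type*} [MetricSpace X] [ChartedSpace (EuclideanSpace ℝ (Fin n)) X]
  [RiemannianBundle (fun x : X => TangentSpace (𝓡 n) x)]
  {α κ₂ κ₃ κ₄ : ℝ} {φ : ℕ → X → ℂ} {ℓ : ℕ → ℝ}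

theorem HeatKernelBounds.gaussianBounds (h : HeatKernelBounds (n := n) α κ₂ κ₃ κ₄ φ ℓ) :
    GaussianBounds α κ₂ κ₃ κ₄ φ ℓ :=
  ⟨h.upper, h.lower⟩

variable [IsManifold (𝓡 n) ∞ X]
  [IsContMDiffRiemannianBundle (𝓡 n) ∞ (EuclideanSpace ℝ (Fin n))
      (fun x : X => TangentSpace (𝓡 n) x)]
  [IsRiemannianManifold (𝓡 n) X]

/-- The points y, z are within 2Aδ < 3Aδ of each other, and B(y, 3Aδ) lies within 4Aδ ≤ 4Ar of x₀.
There the weight changes by at most the factor 1 + 4A, so the gradient bound can be recentred at x₀;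
its extra 1/r produces δ/r. -/
theorem HeatKernelBounds.norm_sub_le (h : HeatKernelBounds (n := n) α κ₂ κ₃ κ₄ φ ℓ)
    (hκ₂ : 0 < κ₂) (hκ₃ : 0 < κ₃) {A : ℝ} (hA : 0 < A) (M : ℕ) {r δ : ℝ} (hδ : 0 < δ)
    (hδr : δ ≤ r) (hr1 : r ≤ 1) {x₀ y z : X} (hy : dist x₀ y ≤ A * δ) (hz : dist x₀ z ≤ A * δ)
    (x : X) : ‖heatKernel φ ℓ (r ^ 2) x y - heatKernel φ ℓ (r ^ 2) x z‖ ≤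
      κ₂ * Real.exp ((M : ℝ) ^ 2 / (4 * κ₃)) * (1 + 4 * A) ^ M * (3 * A) * (δ / r) * r ^ (-α) *
        (locWeight r x₀ x ^ M)⁻¹ := by
  have hr : 0 < r := hδ.trans_le hδr
  have hw := locWeight_pos hr x₀ x
  have hmv := norm_sub_le_of_norm_dirDeriv_le (n := n)
    (h.differentiable (r ^ 2) (by positivity) (by nlinarith) x) (y := y) (z := z)
    (B := κ₂ * r ^ (-(α + 1)) * (Real.exp ((M : ℝ) ^ 2 / (4 * κ₃)) * ((1 + 4 * A) ^ M *
      (locWeight r x₀ x ^ M)⁻¹))) (R := 3 * A * δ) (by positivity) ?_ fun u hu v => ?_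
  · refine hmv.trans_eq ?_
    rw [neg_add, Real.rpow_add hr, Real.rpow_neg_one]
    ring
  · calc dist y z ≤ dist y x₀ + dist x₀ z := dist_triangle _ _ _
      _ < 3 * A * δ := by
        rw [dist_comm y]
        nlinarith [mul_pos hA hδ]
  · refine (h.gradient (r ^ 2) (by positivity) (by nlinarith) x u v).trans ?_
    have h1 : -α / 2 - 1 / 2 = -(α + 1) / 2 := by ring
    rw [h1, sq_rpow_neg_div_two hr]
    have hwu := locWeight_pos hr x u
    have h2 : dist u x₀ ≤ 4 * A * r := by
      calc dist u x₀ ≤ dist u y + dist y x₀ := dist_triangle _ _ _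
        _ ≤ 3 * A * δ + A * δ := by
          rw [dist_comm u, dist_comm y x₀]
          exact add_le_add hu.le hy
        _ = 4 * A * δ := by ring
        _ ≤ _ := by gcongr
    have h3 : locWeight r x₀ x ≤ (1 + 4 * A) * locWeight r x u := by
      rw [locWeight_comm r x₀ x, mul_comm]
      exact (locWeight_le_mul hr x u x₀).trans
        (mul_le_mul_of_nonneg_left (locWeight_le_of_dist_le hr h2) hwu.le)
    have h4 : (locWeight r x u ^ M)⁻¹ ≤ (1 + 4 * A) ^ M * (locWeight r x₀ x ^ M)⁻¹ := by
      rw [← div_eq_mul_inv, inv_eq_one_div, div_le_div_iff₀ (by positivity) (by positivity),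
        one_mul, ← mul_pow]
      exact pow_le_pow_left₀ hw.le h3 M
    have h5 := exp_neg_le_locWeight hκ₃ hr M x u
    gcongr
    exact h5.trans (by gcongr)

/-- Local oscillation of diffusion polynomials. -/
theorem exists_norm_sub_le [CompactSpace X] [MeasurableSpace X] [BorelSpace X]
    {μ : Measure X} [IsProbabilityMeasure μ] (hκ₂ : 0 < κ₂) (hκ₃ : 0 < κ₃) (hκ₄ : 0 < κ₄) {A : ℝ} (hA : 0 < A)
    {m : ℕ} {V : ℝ} (hV : 0 < V) (hvol : ∀ r : ℝ, 0 < r → ∀ x : X,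
      ∫⁻ y, ENNReal.ofReal ((locWeight r x y ^ m)⁻¹) ∂μ ≤ ENNReal.ofReal (V * r ^ α)) :
    ∃ C : ℝ, 0 ≤ C ∧ ∀ (φ : ℕ → X → ℂ) (ℓ : ℕ → ℝ), IsOrthonormalSystem μ φ ℓ →
      HeatKernelBounds (n := n) α κ₂ κ₃ κ₄ φ ℓ → ∀ r δ : ℝ, 0 < δ → δ ≤ r → r ≤ 1 →
      ∀ P ∈ diffusionPolynomials φ ℓ r⁻¹, ∀ x₀ y z : X, dist x₀ y ≤ A * δ → dist x₀ z ≤ A * δ →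
        ‖P y - P z‖ ≤
          C * (δ / r) * ∫ u, ‖P u‖ * (r ^ (-α) * (locWeight r x₀ u ^ m)⁻¹) ∂μ := by
  obtain ⟨C, hC, hmain⟩ := exists_norm_sub_le_of_heatKernel_sub_le (μ := μ) hκ₂ hκ₃ hκ₄ hV hvol
  refine ⟨C * (κ₂ * Real.exp (((2 * m : ℕ) : ℝ) ^ 2 / (4 * κ₃)) * (1 + 4 * A) ^ (2 * m) * (3 * A)),
    by positivity, fun φ ℓ hs hh r δ hδ hδr hr1 P hP x₀ y z hy hz => ?_⟩
  have hr : 0 < r := hδ.trans_le hδr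
  refine (hmain φ ℓ hs hh.gaussianBounds r hr hr1 x₀ y z _ (by positivity)
    (hh.norm_sub_le hκ₂ hκ₃ hA (2 * m) hδ hδr hr1 hy hz) P hP).trans_eq ?_
  have : ∀ u, ‖P u‖ * (r ^ (-α) * (locWeight r x₀ u ^ m)⁻¹) =
      r ^ (-α) * (‖P u‖ * (locWeight r x₀ u ^ m)⁻¹) := fun u => by ring
  simp_rw [this, integral_const_mul]
  ring

end Manifold

/-! ### Elementary inequalities for p-th powers. -/

theorem rpow_sub_one_mul_self {a p : ℝ} (ha : 0 ≤ a) (hp : 1 ≤ p) : a ^ (p - 1) * a = a ^ p := by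
  have := Real.rpow_add_one' ha (y := p - 1) (by linarith)
  rw [← this, sub_add_cancel]

/-- Bernoulli's inequality for (b/a)^p gives a linear dependence on p, which is why L need only
shrink like 1/p. -/
theorem abs_rpow_sub_rpow_le {a b s p : ℝ} (ha : 0 ≤ a) (hb : 0 ≤ b) (has : a ≤ s) (hbs : b ≤ s)
    (hp : 1 ≤ p) : |a ^ p - b ^ p| ≤ p * s ^ (p - 1) * |a - b| := by
  wlog hab : b ≤ a generalizing a b
  · rw [abs_sub_comm, abs_sub_comm a b]
    exact this hb ha hbs has (le_of_not_ge hab)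
  have hp0 : 0 ≤ p := by linarith
  rw [abs_of_nonneg (sub_nonneg.2 (Real.rpow_le_rpow hb hab hp0)),
    abs_of_nonneg (sub_nonneg.2 hab)]
  rcases ha.eq_or_lt with rfl | ha
  · obtain rfl : b = 0 := le_antisymm hab hb
    simp
  have h1 : 1 + p * (b / a - 1) ≤ (b / a) ^ p := by
    have := one_add_mul_self_le_rpow_one_add (s := b / a - 1)
      (by linarith [div_nonneg hb ha.le]) hp
    rwa [add_sub_cancel] at this
  rw [Real.div_rpow hb ha.le, le_div_iff₀ (Real.rpow_pos_of_pos ha p)] at h1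
  have h2 := rpow_sub_one_mul_self ha.le hp
  have h3 : (1 + p * (b / a - 1)) * a ^ p = a ^ p - p * a ^ (p - 1) * (a - b) := by
    rw [← h2]
    field_simp
    ring
  have h4 : p * a ^ (p - 1) * (a - b) ≤ p * s ^ (p - 1) * (a - b) := by
    gcongr
  linarith

/-- The larger of s and b dominates the product. This replaces Young's inequality, with constant 1
for every p. -/
theorem rpow_sub_one_mul_le {s b p : ℝ} (hs : 0 ≤ s) (hb : 0 ≤ b) (hp : 1 ≤ p) :
    s ^ (p - 1) * b ≤ s ^ p + b ^ p := by
  have hp1 : 0 ≤ p - 1 := by linarith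
  rcases le_total s b with h | h
  · calc s ^ (p - 1) * b ≤ b ^ (p - 1) * b := by gcongr
      _ = b ^ p := rpow_sub_one_mul_self hb hp
      _ ≤ _ := le_add_of_nonneg_left (by positivity)
  · calc s ^ (p - 1) * b ≤ s ^ (p - 1) * s := by gcongr
      _ = s ^ p := rpow_sub_one_mul_self hs hp
      _ ≤ _ := le_add_of_nonneg_right (by positivity)

/-! ### Bounded overlap and the oscillation sum over the nodes. -/

section Sampling

variable {X : Type*} [MetricSpace X] [MeasurableSpace X] [BorelSpace X]
  {μ : Measure X} [IsProbabilityMeasure μ] {α κ₁ κ c : ℝ}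

open scoped Classical in
/-- Balls of radius `δ` around points of separation `≳ δ` have bounded overlap. -/
theorem card_filter_mem_closedBall_le (hc : 0 < c) (hκ : 1 ≤ κ)
    (hball : ∀ (x : X) (r : ℝ), 0 < r → μ.real (Metric.closedBall x r) ≤ κ₁ * r ^ α)
    (hlow : ∀ (x : X) (r : ℝ), 0 < r → r ≤ 1 → c * r ^ α ≤ μ.real (Metric.closedBall x r))
    {C : Finset X} {δ : ℝ} (hδ : 0 < δ) (hδ1 : δ ≤ 1) (hq : δ ≤ κ * minSeparation C) (y : X) :
    ((C.filter fun x => y ∈ Metric.closedBall x δ).card : ℝ) ≤ κ₁ * 2 ^ α * (3 * κ) ^ α / c := by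
  set S := C.filter fun x => y ∈ Metric.closedBall x δ with hS
  have hκ0 : 0 < κ := by linarith
  -- Then 3s ≤ q, so the balls of radius s about the nodes are disjoint. Those counted lie in B(y,
  -- 2δ), and comparing volumes bounds their number.
  set s := δ / (3 * κ) with hs
  have hs0 : 0 < s := by positivity
  have hsδ : s ≤ δ := div_le_self hδ.le (by linarith)
  have hsq : 3 * s ≤ minSeparation C := by
    have : 3 * s = δ / κ := by rw [hs]; field_simp
    rw [this, div_le_iff₀ hκ0]
    linarith
  have hdisj : (S : Set X).PairwiseDisjoint fun x => Metric.closedBall x s := by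
    intro x hx x' hx' hne
    refine Metric.closedBall_disjoint_closedBall ?_
    have hx1 : x ∈ (C : Set X) := (Finset.mem_filter.1 hx).1
    have hx1' : x' ∈ (C : Set X) := (Finset.mem_filter.1 hx').1
    have : minSeparation C ≤ dist x x' := Set.infsep_le_dist_of_mem hx1 hx1' hne
    linarith
  have hsub : (⋃ x ∈ S, Metric.closedBall x s) ⊆ Metric.closedBall y (2 * δ) := by
    refine Set.iUnion₂_subset fun x hx => Metric.closedBall_subset_closedBall' ?_
    have : y ∈ Metric.closedBall x δ := (Finset.mem_filter.1 hx).2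
    rw [Metric.mem_closedBall, dist_comm] at this
    linarith
  have h1 : (S.card : ℝ) * (c * s ^ α) ≤ κ₁ * (2 * δ) ^ α := by
    calc (S.card : ℝ) * (c * s ^ α) = ∑ _x ∈ S, c * s ^ α := by
          rw [Finset.sum_const, nsmul_eq_mul]
      _ ≤ ∑ x ∈ S, μ.real (Metric.closedBall x s) :=
          Finset.sum_le_sum fun x _ => hlow x s hs0 (hsδ.trans hδ1)
      _ = μ.real (⋃ x ∈ S, Metric.closedBall x s) :=
          (measureReal_biUnion_finset hdisj fun x _ =>
            Metric.isClosed_closedBall.measurableSet).symm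
      _ ≤ μ.real (Metric.closedBall y (2 * δ)) := measureReal_mono hsub
      _ ≤ _ := hball y _ (by positivity)
  have hδα : 0 < δ ^ α := Real.rpow_pos_of_pos hδ α
  have hκα : 0 < (3 * κ) ^ α := by positivity
  rw [hs, Real.div_rpow hδ.le (by positivity), Real.mul_rpow two_pos.le hδ.le] at h1
  rw [le_div_iff₀ hc]
  have h2 : (S.card : ℝ) * (c * (δ ^ α / (3 * κ) ^ α)) = S.card * c * (δ ^ α / (3 * κ) ^ α) := by
    ring
  rw [h2, ← le_div_iff₀ (by positivity)] at h1
  refine h1.trans_eq ?_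
  field_simp

variable [CompactSpace X]

open scoped Classical in
theorem sum_setIntegral_closedBall_le {C : Finset X} {δ N : ℝ}
    (hN : ∀ y, ((C.filter fun x => y ∈ Metric.closedBall x δ).card : ℝ) ≤ N)
    {f : X → ℝ} (hf : Continuous f) (hf0 : ∀ x, 0 ≤ f x) :
    ∑ x ∈ C, ∫ y in Metric.closedBall x δ, f y ∂μ ≤ N * ∫ y, f y ∂μ := by
  have hm : ∀ x : X, MeasurableSet (Metric.closedBall x δ) := fun x =>
    Metric.isClosed_closedBall.measurableSet
  have hi : Integrable f μ := integrable_of_continuous hf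
  simp_rw [← integral_indicator (hm _)]
  rw [← integral_finsetSum _ fun x _ => hi.indicator (hm x), ← integral_const_mul]
  refine integral_mono (integrable_finsetSum _ fun x _ => hi.indicator (hm x)) (hi.const_mul N)
    fun y => ?_
  simp only [Set.indicator_apply]
  rw [← Finset.sum_filter, Finset.sum_const, nsmul_eq_mul]
  exact mul_le_mul_of_nonneg_right (hN y) (hf0 y)

open scoped Classical in
/-- The Marcinkiewicz-Zygmund type oscillation inequality for a function with controlled local
oscillation. -/
theorem sum_measure_mul_iSup_le {C : Finset X} {δ N r θ V A p : ℝ} {m : ℕ} {P : X → ℂ}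
    (hN0 : 0 ≤ N) (hδ : 0 < δ) (hδr : δ ≤ r) (hV : 0 < V) (hA : 1 ≤ A) (hp : 1 ≤ p) (hθ : 0 ≤ θ)
    (hN : ∀ y, ((C.filter fun x => y ∈ Metric.closedBall x δ).card : ℝ) ≤ N)
    (hvol : ∀ x : X, ∫ y, r ^ (-α) * (locWeight r x y ^ m)⁻¹ ∂μ ≤ V)
    (hP : Continuous P)
    (hosc : ∀ x y z : X, dist x y ≤ A * δ → dist x z ≤ A * δ →
      ‖P y - P z‖ ≤ θ * ∫ u, ‖P u‖ * (r ^ (-α) * (locWeight r x u ^ m)⁻¹) ∂μ)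
    (hsmall : p * θ * V ≤ 1 / 2) :
    (∀ x, ∀ y ∈ Metric.closedBall x (A * δ), ∀ z ∈ Metric.closedBall x (A * δ),
      |‖P y‖ ^ p - ‖P z‖ ^ p| ≤ ⨆ w : Metric.closedBall x (A * δ) × Metric.closedBall x (A * δ),
        |‖P w.1‖ ^ p - ‖P w.2‖ ^ p|) ∧
    ∑ x ∈ C, μ.real (Metric.closedBall x δ) *
      (⨆ w : Metric.closedBall x (A * δ) × Metric.closedBall x (A * δ),
        |‖P w.1‖ ^ p - ‖P w.2‖ ^ p|) ≤
      p * θ * (2 * N * V * (1 + 2 ^ m)) * ∫ x, ‖P x‖ ^ p ∂μ := by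
  have hr : 0 < r := hδ.trans_le hδr
  have hp0 : 0 ≤ p := by linarith
  have hAδ : 0 < A * δ := by positivity
  have hδA : δ ≤ A * δ := le_mul_of_one_le_left hδ.le hA
  set k : X → X → ℝ := fun x u => r ^ (-α) * (locWeight r x u ^ m)⁻¹ with hk
  have hk0 : ∀ x u, 0 ≤ k x u := fun x u => by
    have := locWeight_pos hr x u
    positivity
  have hkc : ∀ x, Continuous (k x) := fun x =>
    continuous_const.mul (continuous_inv_locWeight_pow hr m x)
  have hPp : Continuous fun u => ‖P u‖ ^ p := hP.norm.rpow_const fun _ => Or.inr hp0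
  set I := ∫ u, ‖P u‖ ^ p ∂μ with hI
  have hI0 : 0 ≤ I := integral_nonneg fun u => by simp only [Pi.zero_apply]; positivity
  -- maxima of `|P|` on the balls `B(x, A δ)`
  have hmax : ∀ x, ∃ x' ∈ Metric.closedBall x (A * δ), ∀ y ∈ Metric.closedBall x (A * δ),
      ‖P y‖ ≤ ‖P x'‖ := fun x =>
    Metric.isClosed_closedBall.isCompact.exists_isMaxOn ⟨x, Metric.mem_closedBall_self hAδ.le⟩
      hP.norm.continuousOn
  choose b hb hbmax using hmax
  set s : X → ℝ := fun x => ‖P (b x)‖ with hs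
  have hs0 : ∀ x, 0 ≤ s x := fun x => norm_nonneg _
  set D : X → ℝ := fun x => p * s x ^ (p - 1) * (θ * ∫ u, ‖P u‖ * k x u ∂μ) with hD
  have hpair : ∀ x, ∀ y ∈ Metric.closedBall x (A * δ), ∀ z ∈ Metric.closedBall x (A * δ),
      |‖P y‖ ^ p - ‖P z‖ ^ p| ≤ D x := by
    intro x y hy z hz
    refine (abs_rpow_sub_rpow_le (norm_nonneg _) (norm_nonneg _) (hbmax x y hy) (hbmax x z hz)
      hp).trans ?_
    rw [Metric.mem_closedBall, dist_comm] at hy hz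
    have h1 := (abs_norm_sub_norm_le (P y) (P z)).trans (hosc x y z hy hz)
    have := hs0 x
    exact mul_le_mul_of_nonneg_left h1 (by positivity)
  set o : X → ℝ := fun x => ⨆ w : Metric.closedBall x (A * δ) × Metric.closedBall x (A * δ),
        |‖P w.1‖ ^ p - ‖P w.2‖ ^ p| with ho
  have hoD : ∀ x, o x ≤ D x := fun x => by
    have : Nonempty (Metric.closedBall x (A * δ)) := ⟨x, Metric.mem_closedBall_self hAδ.le⟩
    exact ciSup_le fun w => hpair x _ w.1.2 _ w.2.2
  -- Boundedness by D must be supplied: an unbounded real supremum would default to 0.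
  have hpo : ∀ x, ∀ y ∈ Metric.closedBall x (A * δ), ∀ z ∈ Metric.closedBall x (A * δ),
      |‖P y‖ ^ p - ‖P z‖ ^ p| ≤ o x := fun x y hy z hz =>
    le_ciSup (f := fun w : Metric.closedBall x (A * δ) × Metric.closedBall x (A * δ) =>
      |‖P w.1‖ ^ p - ‖P w.2‖ ^ p|) ⟨D x, by
        rintro _ ⟨w, rfl⟩
        exact hpair x _ w.1.2 _ w.2.2⟩ (⟨y, hy⟩, ⟨z, hz⟩)
  refine ⟨hpo, ?_⟩
  set M : X → ℝ := fun x => μ.real (Metric.closedBall x δ) with hM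
  have hM0 : ∀ x, 0 ≤ M x := fun x => measureReal_nonneg
  set O := ∑ x ∈ C, M x * o x with hO
  set S := ∑ x ∈ C, M x * s x ^ p with hSdef
  have hmeas : ∀ x : X, MeasurableSet (Metric.closedBall x δ) := fun x =>
    Metric.isClosed_closedBall.measurableSet
  -- `S ≤ N I + O`
  have hS : S ≤ N * I + O := by
    have h1 : ∀ x ∈ C, M x * s x ^ p ≤ ∫ y in Metric.closedBall x δ, ‖P y‖ ^ p ∂μ + M x * o x := by
      intro x _
      have h2 : ∫ _y in Metric.closedBall x δ, s x ^ p ∂μ ≤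
          ∫ y in Metric.closedBall x δ, (‖P y‖ ^ p + o x) ∂μ := by
        refine setIntegral_mono_on (integrable_const _).integrableOn
          ((integrable_of_continuous hPp).add (integrable_const _)).integrableOn (hmeas x)
          fun y hy => ?_
        have := hpo x (b x) (hb x) y (Metric.closedBall_subset_closedBall hδA hy)
        linarith [(abs_le.1 this).2]
      rw [integral_add (integrable_of_continuous hPp).integrableOn
        (integrable_const _).integrableOn, setIntegral_const, setIntegral_const, smul_eq_mul,
        smul_eq_mul] at h2
      exact h2
    refine (Finset.sum_le_sum h1).trans ?_
    rw [Finset.sum_add_distrib]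
    gcongr
    exact sum_setIntegral_closedBall_le hN hPp fun x => by positivity
  -- `∑ₓ μ(B(x, δ)) k(x, u) ≤ 2 ^ m N V`
  have hsumk : ∀ u, ∑ x ∈ C, M x * k x u ≤ 2 ^ m * (N * V) := by
    intro u
    have h1 : ∀ x ∈ C, M x * k x u ≤ 2 ^ m * ∫ y in Metric.closedBall x δ, k u y ∂μ := by
      intro x _
      have h2 : ∫ _y in Metric.closedBall x δ, k x u ∂μ ≤
          ∫ y in Metric.closedBall x δ, 2 ^ m * k u y ∂μ := by
        refine setIntegral_mono_on (integrable_const _).integrableOn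
          ((integrable_of_continuous (hkc u)).const_mul _).integrableOn (hmeas x) fun y hy => ?_
        have hw := locWeight_pos hr x u
        have hw' := locWeight_pos hr u y
        have h3 : locWeight r u y ≤ 2 * locWeight r x u := by
          rw [Metric.mem_closedBall] at hy
          have h4 : locWeight r x y ≤ 1 + 1 :=
            locWeight_le_of_dist_le hr (by rw [dist_comm]; linarith)
          calc locWeight r u y ≤ locWeight r u x * locWeight r x y := locWeight_le_mul hr _ _ _
            _ ≤ locWeight r u x * (1 + 1) :=
              mul_le_mul_of_nonneg_left h4 (locWeight_pos hr u x).le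
            _ = _ := by rw [locWeight_comm r u x]; ring
        have h5 : (locWeight r x u ^ m)⁻¹ ≤ 2 ^ m * (locWeight r u y ^ m)⁻¹ := by
          rw [← div_eq_mul_inv, inv_eq_one_div, div_le_div_iff₀ (by positivity) (by positivity),
            one_mul, ← mul_pow]
          exact pow_le_pow_left₀ hw'.le h3 m
        calc k x u ≤ r ^ (-α) * (2 ^ m * (locWeight r u y ^ m)⁻¹) := by
              simp only [hk]
              gcongr
          _ = _ := by simp only [hk]; ring
      rwa [setIntegral_const, smul_eq_mul, integral_const_mul] at h2
    refine (Finset.sum_le_sum h1).trans ?_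
    rw [← Finset.mul_sum]
    gcongr
    refine (sum_setIntegral_closedBall_le hN (hkc u) (hk0 u)).trans ?_
    gcongr
    exact hvol u
  -- the main estimate
  have hkP : ∀ x, Integrable (fun u => ‖P u‖ ^ p * k x u) μ := fun x =>
    integrable_of_continuous (hPp.mul (hkc x))
  have hki : ∀ x, Integrable (fun u => s x ^ p * k x u) μ := fun x =>
    integrable_of_continuous (continuous_const.mul (hkc x))
  have hterm : ∀ x, M x * D x ≤ p * θ * (M x * s x ^ p * V + ∫ u, ‖P u‖ ^ p * (M x * k x u) ∂μ) := by
    intro x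
    have h1 : s x ^ (p - 1) * ∫ u, ‖P u‖ * k x u ∂μ ≤
        s x ^ p * V + ∫ u, ‖P u‖ ^ p * k x u ∂μ := by
      calc s x ^ (p - 1) * ∫ u, ‖P u‖ * k x u ∂μ
          = ∫ u, s x ^ (p - 1) * (‖P u‖ * k x u) ∂μ := (integral_const_mul _ _).symm
        _ ≤ ∫ u, (s x ^ p * k x u + ‖P u‖ ^ p * k x u) ∂μ := by
            refine integral_mono (integrable_of_continuous
              (continuous_const.mul (hP.norm.mul (hkc x))))
              ((hki x).add (hkP x)) fun u => ?_
            simp only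
            rw [← mul_assoc, ← add_mul]
            exact mul_le_mul_of_nonneg_right
              (rpow_sub_one_mul_le (hs0 x) (norm_nonneg _) hp) (hk0 x u)
        _ = s x ^ p * ∫ u, k x u ∂μ + ∫ u, ‖P u‖ ^ p * k x u ∂μ := by
            rw [integral_add (hki x) (hkP x), integral_const_mul]
        _ ≤ _ := by
            have := hs0 x
            gcongr
            exact hvol x
    have h2 : ∫ u, ‖P u‖ ^ p * (M x * k x u) ∂μ = M x * ∫ u, ‖P u‖ ^ p * k x u ∂μ := by
      rw [← integral_const_mul]
      refine integral_congr_ae (ae_of_all _ fun u => ?_)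
      simp only
      ring
    rw [h2]
    calc M x * D x = p * θ * M x * (s x ^ (p - 1) * ∫ u, ‖P u‖ * k x u ∂μ) := by
          rw [hD]; ring
      _ ≤ p * θ * M x * (s x ^ p * V + ∫ u, ‖P u‖ ^ p * k x u ∂μ) := by
          have := hM0 x
          gcongr
      _ = _ := by ring
  have hOle : O ≤ p * θ * (S * V + 2 ^ m * (N * V) * I) := by
    have h1 : O ≤ ∑ x ∈ C, p * θ *
        (M x * s x ^ p * V + ∫ u, ‖P u‖ ^ p * (M x * k x u) ∂μ) :=
      Finset.sum_le_sum fun x _ => (mul_le_mul_of_nonneg_left (hoD x) (hM0 x)).trans (hterm x)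
    have hi : ∀ x ∈ C, Integrable (fun u => ‖P u‖ ^ p * (M x * k x u)) μ := fun x _ =>
      integrable_of_continuous (hPp.mul (continuous_const.mul (hkc x)))
    rw [← Finset.mul_sum, Finset.sum_add_distrib, ← Finset.sum_mul,
      ← integral_finsetSum _ hi] at h1
    refine h1.trans ?_
    gcongr
    rw [hI, ← integral_const_mul]
    refine integral_mono (integrable_finsetSum _ hi)
      ((integrable_of_continuous hPp).const_mul _) fun u => ?_
    simp only
    rw [← Finset.mul_sum, mul_comm]
    exact mul_le_mul_of_nonneg_right (hsumk u) (by positivity)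
  have hpθ : 0 ≤ p * θ := by positivity
  have hO0 : 0 ≤ O := Finset.sum_nonneg fun x _ => mul_nonneg (hM0 x)
    (Real.iSup_nonneg fun w => abs_nonneg _)
  -- Absorption: S ≤ N I + O puts O on the right with coefficient pθV ≤ 1/2, and moving it to the
  -- left costs a factor 2.
  have h6 : p * θ * (S * V) ≤ p * θ * ((N * I + O) * V) := by gcongr
  have h7 : p * θ * V * O ≤ 1 / 2 * O := mul_le_mul_of_nonneg_right hsmall hO0
  linarith

end Sampling

/-! ### Mesh norm, the trivial range L < 1, and the essential supremum. -/

section MeshNorm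

/-- No ℓ_j is below ℓ_0 = 1. This permits assuming L ≥ 1, so that r = 1/L is an admissible heat
scale. -/
theorem diffusionPolynomials_eq_zero {X : Type*} [TopologicalSpace X] [MeasurableSpace X]
    {μ : Measure X} {φ : ℕ → X → ℂ} {ℓ : ℕ → ℝ} (hs : IsOrthonormalSystem μ φ ℓ) {L : ℝ}
    (hL : L < 1) {P : X → ℂ} (hP : P ∈ diffusionPolynomials φ ℓ L) : P = 0 := by
  have : {f | ∃ j, ℓ j ≤ L ∧ f = φ j} = (∅ : Set (X → ℂ)) := by
    refine Set.eq_empty_of_forall_notMem ?_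
    rintro _ ⟨j, hj, -⟩
    have : 1 ≤ ℓ j := hs.ell_zero ▸ hs.mono (Nat.zero_le j)
    linarith
  rw [diffusionPolynomials, this, Submodule.span_empty] at hP
  exact (Submodule.mem_bot ℂ).1 hP

theorem exists_dist_le_meshNorm {X : Type*} [MetricSpace X] [CompactSpace X] {C : Finset X}
    (hC : C.Nonempty) (x : X) : ∃ y ∈ C, dist y x ≤ meshNorm C := by
  obtain ⟨y, hy, hxy⟩ := C.finite_toSet.isCompact.exists_infDist_eq_dist hC x
  refine ⟨y, hy, ?_⟩
  rw [dist_comm, ← hxy]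
  exact le_ciSup (f := fun x => Metric.infDist x (C : Set X))
    (isCompact_range (Metric.continuous_infDist_pt _)).bddAbove x

theorem eLpNorm_top_le {X : Type*} [MeasurableSpace X] {μ : Measure X} {P : X → ℂ} {B : ℝ}
    (hB : 0 ≤ B) (h : ∀ x, ‖P x‖ ≤ B) : (eLpNorm P ∞ μ).toReal ≤ B := by
  rw [eLpNorm_exponent_top]
  exact ENNReal.toReal_le_of_le_ofReal hB (eLpNormEssSup_le_of_ae_bound (ae_of_all _ h))

variable {X : Type*} [MetricSpace X] [MeasurableSpace X] {μ : Measure X} {α κ₁ : ℝ}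

theorem nullSingletonClass_of_measure_closedBall_le [IsFiniteMeasure μ] (hα : 0 < α)
    (hball : ∀ (x : X) (r : ℝ), 0 < r → μ.real (Metric.closedBall x r) ≤ κ₁ * r ^ α) :
    NullSingletonClass μ := by
  refine ⟨fun x => ?_⟩
  have h1 : Tendsto (fun r : ℝ => κ₁ * r ^ α) (nhdsWithin 0 (Set.Ioi 0)) (nhds 0) := by
    have h2 : ContinuousAt (fun r : ℝ => κ₁ * r ^ α) 0 :=
      (Real.continuousAt_rpow_const 0 α (Or.inr hα.le)).const_mul κ₁
    have h3 := h2.tendsto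
    rw [Real.zero_rpow hα.ne', mul_zero] at h3
    exact h3.mono_left nhdsWithin_le_nhds
  have h4 : μ.real {x} ≤ 0 := by
    refine ge_of_tendsto h1 ?_
    filter_upwards [self_mem_nhdsWithin] with r hr
    refine (measureReal_mono ?_).trans (hball x r hr)
    exact Set.singleton_subset_iff.2 (Metric.mem_closedBall_self (le_of_lt hr))
  exact (measureReal_eq_zero_iff).1 (le_antisymm h4 measureReal_nonneg)

/-- The ball condition rules out atoms, so a finite set is null and cannot be the whole space. -/
theorem meshNorm_pos [IsProbabilityMeasure μ] (hα : 0 < α)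
    (hball : ∀ (x : X) (r : ℝ), 0 < r → μ.real (Metric.closedBall x r) ≤ κ₁ * r ^ α)
    [CompactSpace X] {C : Finset X} (hC : C.Nonempty) : 0 < meshNorm C := by
  have hn := nullSingletonClass_of_measure_closedBall_le hα hball
  obtain ⟨x, hx⟩ : ∃ x, x ∉ (C : Set X) := by
    by_contra! h
    have h1 : (C : Set X) = Set.univ := Set.eq_univ_of_forall h
    have h2 : μ (C : Set X) = 0 := C.finite_toSet.measure_zero μ
    rw [h1, measure_univ] at h2
    exact one_ne_zero h2
  have h3 : 0 < Metric.infDist x (C : Set X) :=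
    (C.finite_toSet.isClosed.notMem_iff_infDist_pos hC).1 hx
  refine h3.trans_le (le_ciSup (f := fun x => Metric.infDist x (C : Set X)) ?_ x)
  exact (isCompact_range (Metric.continuous_infDist_pt _)).bddAbove

theorem norm_le_eLpNorm_top [BorelSpace X] [CompactSpace X] [IsFiniteMeasure μ]
    [μ.IsOpenPosMeasure] {P : X → ℂ} (hP : Continuous P) (x : X) :
    ‖P x‖ ≤ (eLpNorm P ∞ μ).toReal := by
  have hfin : eLpNorm P ∞ μ ≠ ⊤ := by
    obtain ⟨B, hB⟩ := isCompact_univ.exists_bound_of_continuousOn hP.continuousOn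
    exact (memLp_top_of_bound hP.aestronglyMeasurable B (ae_of_all _ fun x => hB x trivial)).2.ne
  by_contra! h
  set U : Set X := {y | (eLpNorm P ∞ μ).toReal < ‖P y‖} with hU
  have hUo : IsOpen U := isOpen_lt continuous_const hP.norm
  have h0 : μ U = 0 := by
    have h1 := ae_le_eLpNormEssSup (f := P) (μ := μ)
    refine measure_mono_null (fun y hy => ?_) (mem_ae_iff.1 h1)
    rw [Set.mem_compl_iff, Set.mem_ofPred_eq, not_le, ← eLpNorm_exponent_top,
      ← ENNReal.ofReal_toReal hfin, ← ofReal_norm]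
    have hy' : (eLpNorm P ∞ μ).toReal < ‖P y‖ := hy
    exact (ENNReal.ofReal_lt_ofReal_iff (ENNReal.toReal_nonneg.trans_lt hy')).2 hy'
  exact (hUo.measure_pos μ ⟨x, h⟩).ne' h0

end MeshNorm

end DiffusionMZ

/-! ### Choice of constants and the three inequalities. -/

theorem mainTheorem1 {n : ℕ} {X : Type*} [MetricSpace X] [CompactSpace X] [ConnectedSpace X]
    [ChartedSpace (EuclideanSpace ℝ (Fin n)) X] [IsManifold (𝓡 n) ∞ X]
    [RiemannianBundle (fun x : X => TangentSpace (𝓡 n) x)]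
    [IsContMDiffRiemannianBundle (𝓡 n) ∞ (EuclideanSpace ℝ (Fin n))
      (fun x : X => TangentSpace (𝓡 n) x)]
    [IsRiemannianManifold (𝓡 n) X]
    [MeasurableSpace X] [BorelSpace X] (μ : Measure X) [IsProbabilityMeasure μ]
    (α κ₁ κ₂ κ₃ κ₄ : ℝ) (hα : 0 < α) (hκ₁ : 0 < κ₁) (hκ₂ : 0 < κ₂) (hκ₃ : 0 < κ₃) (hκ₄ : 0 < κ₄)
    (hball : ∀ (x : X) (r : ℝ), 0 < r → μ.real (Metric.closedBall x r) ≤ κ₁ * r ^ α)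
    (κ A : ℝ) (hκ : 1 ≤ κ) (hA : 2 ≤ A) :
    ∃ c₁ c₂ c₃ c₄ : ℝ, 0 < c₁ ∧ 0 < c₂ ∧ 0 < c₃ ∧ 0 < c₄ ∧
      ∀ (φ : ℕ → X → ℂ) (ℓ : ℕ → ℝ),
        DiffusionMZ.IsOrthonormalSystem μ φ ℓ →
        DiffusionMZ.HeatKernelBounds (n := n) α κ₂ κ₃ κ₄ φ ℓ →
        DiffusionMZ.BesselCondition (n := n) μ φ →
      ∀ C : Finset X, ∀ hC : C.Nonempty,
        DiffusionMZ.minSeparation C / 2 ≤ DiffusionMZ.meshNorm C →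
        DiffusionMZ.meshNorm C ≤ κ * DiffusionMZ.minSeparation C →
        -- part (a)
        (∀ p : ℝ, 1 ≤ p → ∀ η : ℝ, 0 < η → η ≤ 1 → DiffusionMZ.meshNorm C ≤ c₁ →
          ∀ L : ℝ, L ≤ c₂ * η / (p * DiffusionMZ.meshNorm C) →
          ∀ P ∈ DiffusionMZ.diffusionPolynomials φ ℓ L,
            ∑ x ∈ C, μ.real (Metric.closedBall x (DiffusionMZ.meshNorm C)) *
              (⨆ w : Metric.closedBall x (A * DiffusionMZ.meshNorm C) ×
                  Metric.closedBall x (A * DiffusionMZ.meshNorm C),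
                |‖P w.1‖ ^ p - ‖P w.2‖ ^ p|)
              ≤ η * ∫ x, ‖P x‖ ^ p ∂μ) ∧
        -- part (b)
        (∀ p : ℝ, 1 ≤ p → ∀ η : ℝ, 0 < η → η ≤ 1 → DiffusionMZ.meshNorm C ≤ c₁ →
          ∀ Y : X → Set X, (∀ x ∈ C, MeasurableSet (Y x)) →
            (C : Set X).PairwiseDisjoint Y → (⋃ x ∈ C, Y x) = Set.univ →
            (∀ x ∈ C, x ∈ Y x ∧ Y x ⊆ Metric.closedBall x (A * DiffusionMZ.meshNorm C)) →
          ∀ L : ℝ, L ≤ c₃ * η / (p * DiffusionMZ.meshNorm C) →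
          ∀ P ∈ DiffusionMZ.diffusionPolynomials φ ℓ L,
            |(∫ x, ‖P x‖ ^ p ∂μ) - ∑ x ∈ C, μ.real (Y x) * ‖P x‖ ^ p|
              ≤ η * ∫ x, ‖P x‖ ^ p ∂μ) ∧
        -- part (c)
        (∀ η : ℝ, 0 < η →
          ∀ L : ℝ, L ≤ c₄ * η / DiffusionMZ.meshNorm C →
          ∀ P ∈ DiffusionMZ.diffusionPolynomials φ ℓ L,
            |(eLpNorm P ∞ μ).toReal - C.sup' hC (fun x => ‖P x‖)|
              ≤ η * (eLpNorm P ∞ μ).toReal) := by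
  have hA0 : 0 < A := by linarith
  obtain ⟨m, hm⟩ := exists_nat_ge (α + 2)
  obtain ⟨V, hV, hvol⟩ := DiffusionMZ.exists_lintegral_locWeight_le hκ₁ hball hm
  obtain ⟨c, hc, hlow⟩ := DiffusionMZ.exists_le_measure_closedBall (κ₂ := κ₂) (κ₃ := κ₃)
    (κ₄ := κ₄) hκ₁ hκ₂ hκ₃ hκ₄ hball
  obtain ⟨K, hK, hosc⟩ := DiffusionMZ.exists_norm_sub_le (n := n) (μ := μ) hκ₂ hκ₃ hκ₄ hA0 hV hvol
  have hvol' : ∀ r : ℝ, 0 < r → ∀ x : X,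
      ∫ y, r ^ (-α) * (DiffusionMZ.locWeight r x y ^ m)⁻¹ ∂μ ≤ V := fun r hr x => by
    have hrα : 0 < r ^ α := Real.rpow_pos_of_pos hr α
    rw [integral_const_mul, Real.rpow_neg hr.le, inv_mul_le_iff₀ hrα, mul_comm]
    exact DiffusionMZ.integral_le_of_lintegral_le (DiffusionMZ.continuous_inv_locWeight_pow hr m x)
      (fun y => by have := DiffusionMZ.locWeight_pos hr x y; positivity) (by positivity)
      (hvol r hr x)
  have hk0 : ∀ r : ℝ, 0 < r → ∀ x u : X,
      0 ≤ r ^ (-α) * (DiffusionMZ.locWeight r x u ^ m)⁻¹ := fun r hr x u => by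
    have := DiffusionMZ.locWeight_pos hr x u
    positivity
  set N := κ₁ * 2 ^ α * (3 * κ) ^ α / c with hNdef
  have hN0 : 0 ≤ N := by positivity
  set G := K * (2 * N * V * (1 + 2 ^ m)) with hG
  have hG0 : 0 ≤ G := by positivity
  -- The three summands give c₂ ≤ 1 (so δ ≤ 1/L), c₂KV ≤ 1/2 (absorption, and part (c)), and c₂G ≤ 1
  -- (final constant in (a)).
  set c₂ := 1 / (1 + 2 * (K * V) + G) with hc₂
  have hKV : 0 ≤ K * V := by positivity
  have hden : 0 < 1 + 2 * (K * V) + G := by positivity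
  have hc₂0 : 0 < c₂ := by positivity
  have hc₂1 : c₂ ≤ 1 := by rw [hc₂, div_le_one hden]; linarith
  have hc₂V : c₂ * (K * V) ≤ 1 / 2 := by
    rw [hc₂, div_mul_eq_mul_div, div_le_div_iff₀ hden two_pos]; linarith
  have hc₂G : c₂ * G ≤ 1 := by
    rw [hc₂, div_mul_eq_mul_div, div_le_one hden]; linarith
  -- A bound for μ(Y_k)/μ(B(x_k,δ)), from the upper volume bound at radius Aδ and the lower one at
  -- δ. The summand 1 keeps η/Γ ≤ 1, so (a) applies with η/Γ.
  set Γ := 1 + κ₁ * A ^ α / c with hΓ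
  have hΓ1 : 1 ≤ Γ := le_add_of_nonneg_right (by positivity)
  have hΓ0 : 0 < Γ := by linarith
  refine ⟨1, c₂, c₂ / Γ, c₂, one_pos, hc₂0, by positivity, hc₂0,
    fun φ ℓ hs hh _ C hC _ hq => ?_⟩
  set δ := DiffusionMZ.meshNorm C with hδdef
  have hδ : 0 < δ := DiffusionMZ.meshNorm_pos hα hball hC
  have hlow' := hlow φ ℓ hs hh.gaussianBounds
  have hosc_sum : ∀ (p : ℝ), 1 ≤ p → ∀ η : ℝ, 0 < η → η ≤ 1 → δ ≤ 1 → ∀ L : ℝ,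
      L ≤ c₂ * η / (p * δ) → ∀ P ∈ DiffusionMZ.diffusionPolynomials φ ℓ L,
      (∀ x, ∀ y ∈ Metric.closedBall x (A * δ), ∀ z ∈ Metric.closedBall x (A * δ),
        |‖P y‖ ^ p - ‖P z‖ ^ p| ≤
          ⨆ w : Metric.closedBall x (A * δ) × Metric.closedBall x (A * δ),
            |‖P w.1‖ ^ p - ‖P w.2‖ ^ p|) ∧
      ∑ x ∈ C, μ.real (Metric.closedBall x δ) *
        (⨆ w : Metric.closedBall x (A * δ) × Metric.closedBall x (A * δ),
          |‖P w.1‖ ^ p - ‖P w.2‖ ^ p|) ≤ η * ∫ x, ‖P x‖ ^ p ∂μ := by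
    intro p hp η hη hη1 hδ1 L hL P hP
    have hp0 : 0 < p := by linarith
    rcases lt_or_ge L 1 with hL1 | hL1
    · obtain rfl := DiffusionMZ.diffusionPolynomials_eq_zero hs hL1 hP
      simp [Real.zero_rpow hp0.ne']
    have hL0 : 0 < L := by linarith
    have hpL : p * (δ * L) ≤ c₂ * η := by
      rw [le_div_iff₀ (by positivity)] at hL
      linarith
    have hδL : δ * L ≤ 1 := by
      calc δ * L ≤ p * (δ * L) := le_mul_of_one_le_left (by positivity) hp
        _ ≤ c₂ * η := hpL
        _ ≤ 1 * 1 := by gcongr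
        _ = 1 := one_mul 1
    have hδr : δ ≤ L⁻¹ := by
      rw [← one_div, le_div_iff₀ hL0]
      exact hδL
    have hr1 : L⁻¹ ≤ 1 := inv_le_one_of_one_le₀ hL1
    have hsmall : p * (K * (δ * L)) * V ≤ 1 / 2 := by
      calc p * (K * (δ * L)) * V = p * (δ * L) * (K * V) := by ring
        _ ≤ c₂ * η * (K * V) := by gcongr
        _ ≤ c₂ * 1 * (K * V) := by gcongr
        _ ≤ 1 / 2 := by rw [mul_one]; exact hc₂V
    have hmain := DiffusionMZ.sum_measure_mul_iSup_le (C := C) (α := α) (μ := μ) hN0 hδ hδr hV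
      (by linarith : 1 ≤ A) hp (by positivity : 0 ≤ K * (δ * L))
      (fun y => DiffusionMZ.card_filter_mem_closedBall_le hc hκ hball hlow' hδ hδ1 hq y)
      (hvol' L⁻¹ (inv_pos.2 hL0))
      (DiffusionMZ.continuous_of_mem_diffusionPolynomials hs.continuous hP)
      (fun x y z hy hz => by
        have := hosc φ ℓ hs hh L⁻¹ δ hδ hδr hr1 P (by rwa [inv_inv]) x y z hy hz
        rwa [div_inv_eq_mul] at this) hsmall
    refine ⟨hmain.1, hmain.2.trans ?_⟩
    have hI0 : 0 ≤ ∫ x, ‖P x‖ ^ p ∂μ := integral_nonneg fun x => by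
      simp only [Pi.zero_apply]; positivity
    refine mul_le_mul_of_nonneg_right ?_ hI0
    calc p * (K * (δ * L)) * (2 * N * V * (1 + 2 ^ m)) = p * (δ * L) * G := by rw [hG]; ring
      _ ≤ c₂ * η * G := by gcongr
      _ = c₂ * G * η := by ring
      _ ≤ 1 * η := by gcongr
      _ = η := one_mul η
  refine ⟨fun p hp η hη hη1 hδ1 L hL P hP => (hosc_sum p hp η hη hη1 hδ1 L hL P hP).2, ?_, ?_⟩
  · intro p hp η hη hη1 hδ1 Y hYm hYd hYu hY L hL P hP
    have hp0 : 0 < p := by linarith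
    obtain ⟨h1, h2⟩ := hosc_sum p hp (η / Γ) (by positivity)
      ((div_le_self hη.le hΓ1).trans hη1) hδ1 L (by
        refine hL.trans_eq ?_
        ring) P hP
    have hPc := DiffusionMZ.continuous_of_mem_diffusionPolynomials hs.continuous hP
    have hint : Integrable (fun x => ‖P x‖ ^ p) μ :=
      DiffusionMZ.integrable_of_continuous (hPc.norm.rpow_const fun _ => Or.inr hp0.le)
    have hI : ∫ x, ‖P x‖ ^ p ∂μ = ∑ x ∈ C, ∫ y in Y x, ‖P y‖ ^ p ∂μ := by
      rw [← integral_biUnion_finset C hYm hYd fun x _ => hint.integrableOn, hYu,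
        setIntegral_univ]
    set o : X → ℝ := fun x => ⨆ w : Metric.closedBall x (A * δ) × Metric.closedBall x (A * δ),
      |‖P w.1‖ ^ p - ‖P w.2‖ ^ p| with ho
    have ho0 : ∀ x, 0 ≤ o x := fun x => Real.iSup_nonneg fun w => abs_nonneg _
    have hYμ : ∀ x ∈ C, μ.real (Y x) ≤ Γ * μ.real (Metric.closedBall x δ) := by
      intro x hx
      calc μ.real (Y x) ≤ μ.real (Metric.closedBall x (A * δ)) := measureReal_mono (hY x hx).2
        _ ≤ κ₁ * (A * δ) ^ α := hball x _ (by positivity)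
        _ = κ₁ * A ^ α / c * (c * δ ^ α) := by
          rw [Real.mul_rpow hA0.le hδ.le]
          field_simp
        _ ≤ Γ * μ.real (Metric.closedBall x δ) := by
          gcongr
          · rw [hΓ]; linarith
          · exact hlow' x δ hδ hδ1
    have hterm : ∀ x ∈ C, |∫ y in Y x, ‖P y‖ ^ p ∂μ - μ.real (Y x) * ‖P x‖ ^ p| ≤
        Γ * (μ.real (Metric.closedBall x δ) * o x) := by
      intro x hx
      have h3 : ∫ y in Y x, ‖P y‖ ^ p ∂μ - μ.real (Y x) * ‖P x‖ ^ p =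
          ∫ y in Y x, (‖P y‖ ^ p - ‖P x‖ ^ p) ∂μ := by
        rw [integral_sub hint.integrableOn (integrable_const _).integrableOn, setIntegral_const,
          smul_eq_mul]
      have h4 := norm_setIntegral_le_of_norm_le_const (measure_lt_top μ (Y x))
        (C := o x) (f := fun y => ‖P y‖ ^ p - ‖P x‖ ^ p) (fun y hy => h1 x y ((hY x hx).2 hy) x
          (Metric.mem_closedBall_self (by positivity)))
      rw [h3, ← Real.norm_eq_abs]
      calc _ ≤ o x * μ.real (Y x) := h4
        _ ≤ o x * (Γ * μ.real (Metric.closedBall x δ)) :=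
          mul_le_mul_of_nonneg_left (hYμ x hx) (ho0 x)
        _ = _ := by ring
    calc |(∫ x, ‖P x‖ ^ p ∂μ) - ∑ x ∈ C, μ.real (Y x) * ‖P x‖ ^ p|
        = |∑ x ∈ C, (∫ y in Y x, ‖P y‖ ^ p ∂μ - μ.real (Y x) * ‖P x‖ ^ p)| := by
          rw [hI, Finset.sum_sub_distrib]
      _ ≤ ∑ x ∈ C, Γ * (μ.real (Metric.closedBall x δ) * o x) :=
          (Finset.abs_sum_le_sum_abs _ _).trans (Finset.sum_le_sum hterm)
      _ = Γ * ∑ x ∈ C, μ.real (Metric.closedBall x δ) * o x := by rw [Finset.mul_sum]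
      _ ≤ Γ * (η / Γ * ∫ x, ‖P x‖ ^ p ∂μ) := by gcongr
      _ = _ := by field_simp
  · intro η hη L hL P hP
    rcases lt_or_ge L 1 with hL1 | hL1
    · obtain rfl := DiffusionMZ.diffusionPolynomials_eq_zero hs hL1 hP
      simp
    have hL0 : 0 < L := by linarith
    have hδL : δ * L ≤ c₂ * η := by
      rw [le_div_iff₀ hδ] at hL
      linarith
    -- The lower volume bound gives every nonempty open set positive measure, so the essential
    -- supremum of a continuous function dominates its values at the nodes.
    have hpos : μ.IsOpenPosMeasure := by
      refine ⟨fun U hU hne h0 => ?_⟩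
      obtain ⟨x, hx⟩ := hne
      obtain ⟨ε, hε, hεU⟩ := Metric.nhds_basis_closedBall.mem_iff.1 (hU.mem_nhds hx)
      have hε' : 0 < min ε 1 := lt_min hε one_pos
      have h1 := hlow' x (min ε 1) hε' (min_le_right _ _)
      have h2 : μ (Metric.closedBall x (min ε 1)) = 0 := measure_mono_null
        ((Metric.closedBall_subset_closedBall (min_le_left _ _)).trans hεU) h0
      rw [measureReal_def, h2, ENNReal.toReal_zero] at h1
      exact absurd h1 (not_le.2 (by positivity))
    have hPc := DiffusionMZ.continuous_of_mem_diffusionPolynomials hs.continuous hP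
    set a := (eLpNorm P ∞ μ).toReal with ha
    have ha0 : 0 ≤ a := ENNReal.toReal_nonneg
    have hPa : ∀ x, ‖P x‖ ≤ a := fun x => DiffusionMZ.norm_le_eLpNorm_top hPc x
    set b := C.sup' hC (fun x => ‖P x‖) with hb
    have hba : b ≤ a := Finset.sup'_le hC _ fun x _ => hPa x
    have hPb : ∀ x ∈ C, ‖P x‖ ≤ b := fun x hx => Finset.le_sup' (fun x => ‖P x‖) hx
    have hb0 : 0 ≤ b := by
      obtain ⟨x, hx⟩ := hC
      exact (norm_nonneg _).trans (hPb x hx)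
    rw [abs_of_nonneg (sub_nonneg.2 hba)]
    -- For η ≥ 1 the claim follows from 0 ≤ b ≤ a. Otherwise δL ≤ c₂η ≤ 1, which already gives δ ≤
    -- 1/L ≤ 1 without a separate smallness assumption on δ.
    rcases le_or_gt 1 η with hη1 | hη1
    · nlinarith
    have hδr : δ ≤ L⁻¹ := by
      rw [← one_div, le_div_iff₀ hL0]
      calc δ * L ≤ c₂ * η := hδL
        _ ≤ 1 * 1 := by gcongr
        _ = 1 := one_mul 1
    have hr0 : 0 < L⁻¹ := inv_pos.2 hL0
    have hPx : ∀ x, ‖P x‖ ≤ b + η * a := by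
      intro x
      obtain ⟨y, hy, hyx⟩ := DiffusionMZ.exists_dist_le_meshNorm hC x
      have h1 := hosc φ ℓ hs hh L⁻¹ δ hδ hδr (inv_le_one_of_one_le₀ hL1) P (by rwa [inv_inv])
        y x y (hyx.trans (le_mul_of_one_le_left hδ.le (by linarith)))
        (by rw [dist_self]; positivity)
      rw [div_inv_eq_mul] at h1
      have hkc : Continuous fun u => L⁻¹ ^ (-α) * (DiffusionMZ.locWeight L⁻¹ y u ^ m)⁻¹ :=
        continuous_const.mul (DiffusionMZ.continuous_inv_locWeight_pow hr0 m y)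
      have h2 : ∫ u, ‖P u‖ * (L⁻¹ ^ (-α) * (DiffusionMZ.locWeight L⁻¹ y u ^ m)⁻¹) ∂μ ≤ a * V := by
        calc _ ≤ ∫ u, a * (L⁻¹ ^ (-α) * (DiffusionMZ.locWeight L⁻¹ y u ^ m)⁻¹) ∂μ :=
              integral_mono (DiffusionMZ.integrable_of_continuous (hPc.norm.mul hkc))
                (DiffusionMZ.integrable_of_continuous (continuous_const.mul hkc)) fun u =>
                mul_le_mul_of_nonneg_right (hPa u) (hk0 L⁻¹ hr0 y u)
          _ ≤ a * V := by
            rw [integral_const_mul]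
            exact mul_le_mul_of_nonneg_left (hvol' L⁻¹ hr0 y) ha0
      have h3 : ‖P x - P y‖ ≤ η * a := by
        calc ‖P x - P y‖ ≤ K * (δ * L) * (a * V) := h1.trans (by gcongr)
          _ = δ * L * (K * V) * a := by ring
          _ ≤ c₂ * η * (K * V) * a := by gcongr
          _ = c₂ * (K * V) * (η * a) := by ring
          _ ≤ 1 / 2 * (η * a) := by gcongr
          _ ≤ η * a := by linarith [mul_nonneg hη.le ha0]
      linarith [norm_le_norm_add_norm_sub' (P x) (P y), hPb y hy]
    linarith [DiffusionMZ.eLpNorm_top_le (μ := μ) (by positivity : 0 ≤ b + η * a) hPx]
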